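/- Fix a real number $\kappa>0$. Let $p=\mathbb P[|Z|\le\kappa]$ for $Z\sim\mathcal N(0,1)$ and $\alpha_c=-\log 2/\log p$. For $\eta>0$ and $n\in\mathbb N$ put $$m=\lfloor\alpha_c n-\eta\log n\rfloor,\qquad K=\lceil\eta\log n\rceil .$$ For a sequence $M=(M_j)_{j\ge1}$ of vectors in $\mathbb R^n$ and $k\ge1$ define $$C_k(m,M)=\frac{1}{(mn)^{k/2}}\sum_{\substack{i_1,\dots,i_k\in[n]\text{ distinct}\\ j_1,\dots,j_k\in[m]\text{ distinct}}}\ \prod_{\ell=1}^kM_{j_\ell,i_\ell}M_{j_\ell,i_{\ell+1}}-\mathbf 1_{k=1}\sqrt{mn},\qquad i_{k+1}:=i_1,$$ and $$V(M)=\Big(\frac{C_1(m,M)}{\sqrt{2\cdot1}},\dots,\frac{C_K(m,M)}{\sqrt{2K}}\Big)\in\mathbb R^K .$$ For $g\in C^3(\mathbb R^K)$ let $M_r(g)=\sup_{x\in\mathbb R^K}\|D^rg(x)\|_{\mathrm{op}}\in[0,\infty]$, where $\|A\|_{\mathrm{op}}=\sup_{|v_1|=\dots=|v_r|=1}|A(v_1,\dots,v_r)|$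 for the Euclidean norm. **Proposition 3.6.** There is $\eta_0>0$, depending only on $\kappa$, such that for every $\eta\in(0,\eta_0]$ there is $N$, depending only on $\kappa$ and $\eta$, such that the following holds for all $n\ge N$. Let $G=(G_j)_{j\ge1}$ be a sequence of independent standard Gaussian vectors in $\mathbb R^n$ and let $Z\sim\mathcal N(0,I_K)$. Then for every $g\in C^3(\mathbb R^K)$, $$\big|\mathbb E\,g(V(G))-\mathbb E\,g(Z)\big|\le\big(M_2(g)+M_3(g)\big)\,n^{-1/4}.$$ Here $g(V(G))$ and $g(Z)$ are integrable whenever $M_2(g)<\infty$; if $M_2(g)+M_3(g)=\infty$, the right-hand side is infinite and the inequality holds trivially. -/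

import Mathlib

open MeasureTheory ProbabilityTheory
open scoped ENNReal

noncomputable section

namespace SymmetricPerceptron

/-- The probability `p = ℙ[|Z| ≤ κ]` for a standard real Gaussian `Z`. -/
def gaussProb (κ : ℝ) : ℝ := (gaussianReal 0 1).real {z : ℝ | |z| ≤ κ}

/-- The critical density `α_c = - log 2 / log p`. -/
def alphaC (κ : ℝ) : ℝ := -Real.log 2 / Real.log (gaussProb κ)

/-- The cutoff time `⌊α_c n - η log n⌋` (a natural number; it is positive for large `n`). -/
def tauPre (κ η : ℝ) (n : ℕ) : ℕ := ⌊alphaC κ * n - η * Real.log n⌋₊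

/-- The maximal half-length `K = ⌈η log n⌉` of the cycles that are counted. -/
def cycleBound (η : ℝ) (n : ℕ) : ℕ := ⌈η * Real.log n⌉₊

/-- The `2k`-cycle count `C_k(m, M)` of a sequence `M` of vectors in `ℝⁿ`. The injections
`i : Fin k ↪ Fin n`, `j : Fin k ↪ Fin m` are the tuples of distinct indices, rows and columns are
numbered from `0`, and `finRotate k ℓ` is the cyclic successor of `ℓ`. -/
def cycleCount {n : ℕ} (k m : ℕ) (M : ℕ → EuclideanSpace ℝ (Fin n)) : ℝ :=
  (1 / √(n : ℝ)) ^ k * (1 / √(m : ℝ)) ^ k *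
      (∑ i : Fin k ↪ Fin n, ∑ j : Fin k ↪ Fin m,
        ∏ ℓ : Fin k, M (j ℓ) (i ℓ) * M (j ℓ) (i (finRotate k ℓ)))
    - if k = 1 then √((m : ℝ) * n) else 0

/-- The normalized vector `V(M) = (C_1(m, M) / √(2·1), …, C_K(m, M) / √(2·K))`; its coordinate
`k : Fin K` is the one of the `2(k+1)`-cycles. -/
def cycleVector {n : ℕ} (K m : ℕ) (M : ℕ → EuclideanSpace ℝ (Fin n)) :
    EuclideanSpace ℝ (Fin K) :=
  WithLp.toLp 2 fun k : Fin K =>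
    cycleCount ((k : ℕ) + 1) m M / √(2 * ((k : ℕ) + 1 : ℝ))

/-- `M_r(g) = sup_x ‖D^r g(x)‖_op`, possibly infinite; the operator norm of the multilinear form
`D^r g(x)` is the one with respect to the Euclidean norm. -/
def derivSup {d : ℕ} (r : ℕ) (g : EuclideanSpace ℝ (Fin d) → ℝ) : ℝ≥0∞ :=
  ⨆ x : EuclideanSpace ℝ (Fin d), ‖iteratedFDeriv ℝ r g x‖ₑ

end SymmetricPerceptron

end

/-!
Write `ι = [m] × [n]` for the set of matrix entries and view every coordinate of `V(G)` as a
polynomial `F_k` in the independent standard Gaussians `x_e`, `e ∈ ι`.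

**Comparison.** Let `F_k = div u_k`, where `div u = ∑ₑ (xₑ uₑ - ∂ₑ uₑ)` is the Gaussian divergence of
a polynomial vector field. Rotating an independent standard Gaussian vector into `F` and integrating
by parts along the way bounds the difference of the two expectations by
`M₂(g) ∑_{k,l} 𝔼 |⟨u_k, ∇F_l⟩ - δ_{kl}|` (`abs_integral_sub_stdGaussian_le`). The second derivative
of `g` suffices, because `F` is compared through its Stein matrix and not by a Lindeberg swap.

**The Stein matrix of the cycle counts.** A cycle is a closing edge together with a self-avoiding
path that joins the ends of this edge. With `u_k` the normalized sum over these paths, `div u_k` is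
the normalized cycle count; the centering `√(mn)` for `k = 1` comes from the terms `∂ₑ uₑ`
(`gaussDiv_pathCoord`). By the dihedral symmetry of cycles, `⟨u_k, ∇F_l⟩` is a multiple of the sum
over pairs of self-avoiding paths, with `2k-1` and `2l-1` edges, that have the same end points
(`eval_steinMatrix_cycles`).

**Its mean and variance.** A path is determined by its end points and its edge set, and it cannot
contain another path with the same end points (`path_agree`). Hence only equal pairs contribute to
the mean, which is a ratio of falling factorials and powers. Two pairs `(P, Q)` and `(P', Q')` of
paths are correlated only if `P ∆ Q = P' ∆ Q'` and they are not trivially disjoint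
(`abs_cov_sqfree_le`), and then `P, Q, P'` determine `Q'`. To count such triples, a path is given
the weight `N ^ #(shared edges)` with `N = n + m`, and the self-avoiding paths are embedded into all
walks: the weighted walks are powers of a matrix whose row and column sums are at most a constant
times `N`, as a path meets every vertex in at most two edges (`sum_pow_card_inter_le`). Being
different from a path with the same end points saves a further factor `N` (`walkSum_sub_le`). This
makes the variance at most `B ^ K / n` up to a factor `3 K ^ 2`, with `B` depending only on `κ`
(`integral_abs_steinMatrix_sub_le`).

**Conclusion.** As `K` is about `η log n`, the choice `η ≤ 1 / (4 log B)` gives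
`B ^ K = O(n ^ (1 / 4))`, so that each of the `K ^ 2` entries is within `O(K n ^ (-3 / 8))` of the
identity matrix, and the sum is below `n ^ (-1 / 4)` for large `n` (`exists_errors_le`).
-/

namespace SymmetricPerceptron

/-! ### Gaussian integration by parts -/

section GaussianIBP

variable {ι : Type*} [Fintype ι]

/-- The law of a family of independent standard real Gaussians indexed by `ι`. -/
noncomputable abbrev stdPi (ι : Type*) [Fintype ι] : Measure (ι → ℝ) :=
  Measure.pi fun _ : ι => gaussianReal 0 1

/-- One-dimensional Gaussian integration by parts. -/
lemma integral_id_mul_gaussianReal {f f' : ℝ → ℝ} (hd : ∀ t, HasDerivAt f (f' t) t)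
    (hf : Integrable f (gaussianReal 0 1)) (hxf : Integrable (fun t => t * f t) (gaussianReal 0 1))
    (hf' : Integrable f' (gaussianReal 0 1)) :
    ∫ t, t * f t ∂(gaussianReal 0 1) = ∫ t, f' t ∂(gaussianReal 0 1) := by
  have h1 : (1 : NNReal) ≠ 0 := one_ne_zero
  have key : ∀ h : ℝ → ℝ, Integrable h (gaussianReal 0 1) →
      Integrable (fun t => gaussianPDFReal 0 1 t * h t) := by
    intro h hh
    rw [gaussianReal_of_var_ne_zero _ h1, gaussianPDF_def,
      integrable_withDensity_iff_integrable_smul' (by fun_prop) (by simp)] at hh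
    simpa [ENNReal.toReal_ofReal (gaussianPDFReal_nonneg _ _ _)] using hh
  have hpdf : ∀ t, HasDerivAt (fun t => gaussianPDFReal 0 1 t) (-(t * gaussianPDFReal 0 1 t)) t := by
    intro t
    have h2 : HasDerivAt (fun t : ℝ => -(t - 0) ^ 2 / (2 * ((1 : NNReal) : ℝ))) (-t) t := by
      have := ((((hasDerivAt_id t).sub_const (0 : ℝ)).pow 2).neg).div_const (2 * ((1 : NNReal) : ℝ))
      refine this.congr_deriv ?_
      norm_num
      ring
    have h3 := (h2.exp).const_mul (√(2 * Real.pi * ((1 : NNReal) : ℝ)))⁻¹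
    simp only [gaussianPDFReal_def]
    refine h3.congr_deriv ?_
    ring
  rw [integral_gaussianReal_eq_integral_smul h1, integral_gaussianReal_eq_integral_smul h1]
  have := integral_mul_deriv_eq_deriv_mul_of_integrable (u := f) (u' := f')
    (v := fun t => gaussianPDFReal 0 1 t) (v' := fun t => -(t * gaussianPDFReal 0 1 t))
    (fun x _ => hd x) (fun x _ => hpdf x)
    ((key _ hxf).neg.congr (ae_of_all _ fun t => by simp; ring))
    ((key _ hf').congr (ae_of_all _ fun t => by simp; ring))
    ((key _ hf).congr (ae_of_all _ fun t => by simp; ring))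
  simp only [smul_eq_mul]
  calc ∫ x, gaussianPDFReal 0 1 x * (x * f x)
      = -∫ x, f x * -(x * gaussianPDFReal 0 1 x) := by
        rw [← integral_neg]; congr 1; ext x; ring
    _ = ∫ x, gaussianPDFReal 0 1 x * f' x := by
        rw [this, neg_neg]; congr 1; ext x; ring

/-- Resampling one coordinate preserves a product of equal probability measures. -/
lemma measurePreserving_update [DecidableEq ι] (μ : Measure ℝ) [IsProbabilityMeasure μ] (e : ι) :
    MeasurePreserving (fun z : (ι → ℝ) × ℝ => Function.update z.1 e z.2)
      ((Measure.pi fun _ : ι => μ).prod μ) (Measure.pi fun _ : ι => μ) := by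
  have hm : Measurable (fun z : (ι → ℝ) × ℝ => Function.update z.1 e z.2) := by
    refine measurable_pi_lambda _ fun i => ?_
    by_cases h : i = e
    · subst h; simpa using measurable_snd
    · simp only [Function.update_of_ne h]
      exact (measurable_pi_apply i).comp measurable_fst
  refine ⟨hm, (Measure.pi_eq fun s hs => ?_).symm⟩
  rw [Measure.map_apply hm (MeasurableSet.univ_pi hs)]
  have : (fun z : (ι → ℝ) × ℝ => Function.update z.1 e z.2) ⁻¹' (Set.univ.pi s)
      = (Set.univ.pi (Function.update s e Set.univ)) ×ˢ (s e) := by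
    ext ⟨x, t⟩
    simp only [Set.mem_preimage, Set.mem_pi, Set.mem_univ, true_imp_iff, Set.mem_prod]
    constructor
    · refine fun h => ⟨fun i => ?_, by simpa using h e⟩
      by_cases hi : i = e
      · subst hi; simp
      · simpa [Function.update_of_ne hi] using h i
    · rintro ⟨h1, h2⟩ i
      by_cases hi : i = e
      · subst hi; simpa using h2
      · simpa [Function.update_of_ne hi] using h1 i
  rw [this, Measure.prod_prod, Measure.pi_pi, ← Finset.mul_prod_erase _ _ (Finset.mem_univ e),
    ← Finset.mul_prod_erase Finset.univ (fun i => μ (s i)) (Finset.mem_univ e)]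
  simp only [Function.update_self, measure_univ, one_mul]
  rw [mul_comm]
  congr 1
  refine Finset.prod_congr rfl fun i hi => ?_
  rw [Function.update_of_ne (Finset.ne_of_mem_erase hi)]

/-- Gaussian integration by parts in one coordinate of a product of standard Gaussians. -/
lemma integral_coord_mul_stdPi [DecidableEq ι] (e : ι) {f f' : (ι → ℝ) → ℝ}
    (hd : ∀ x, HasDerivAt (fun t => f (Function.update x e t)) (f' x) (x e))
    (hf : Integrable f (stdPi ι)) (hxf : Integrable (fun x => x e * f x) (stdPi ι))
    (hf' : Integrable f' (stdPi ι)) :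
    ∫ x, x e * f x ∂(stdPi ι) = ∫ x, f' x ∂(stdPi ι) := by
  have mp := measurePreserving_update (ι := ι) (gaussianReal 0 1) e
  have tr : ∀ h : (ι → ℝ) → ℝ, Integrable h (stdPi ι) →
      ∫ x, h x ∂(stdPi ι)
        = ∫ x, ∫ t, h (Function.update x e t) ∂(gaussianReal 0 1) ∂(stdPi ι) := by
    intro h hh
    have h1 := integral_map mp.measurable.aemeasurable (by rw [mp.map_eq]; exact hh.1) (f := h)
    rw [mp.map_eq] at h1
    exact h1.trans (integral_prod _ (mp.integrable_comp_of_integrable hh))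
  have sl : ∀ h : (ι → ℝ) → ℝ, Integrable h (stdPi ι) →
      ∀ᵐ x ∂(stdPi ι), Integrable (fun t => h (Function.update x e t)) (gaussianReal 0 1) :=
    fun h hh => (mp.integrable_comp_of_integrable hh).prod_right_ae
  rw [tr _ hxf, tr _ hf']
  refine integral_congr_ae ?_
  filter_upwards [sl _ hf, sl _ hxf, sl _ hf'] with x h1 h2 h3
  simp only [Function.update_self] at h2 ⊢
  refine integral_id_mul_gaussianReal (fun t => ?_) h1 h2 h3
  simpa using hd (Function.update x e t)

end GaussianIBP

/-! ### Functions of polynomial growth and the Gaussian divergence -/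

section PolyGrowth

set_option linter.unusedSectionVars false

variable {ι : Type*} [Fintype ι]

/-- At most polynomial growth of a function on `ℝ^ι`. -/
def PolyGrowth (f : (ι → ℝ) → ℝ) : Prop := ∃ (C : ℝ) (q : ℕ), ∀ x, |f x| ≤ C * (1 + ‖x‖) ^ q

lemma PolyGrowth.mono {f g : (ι → ℝ) → ℝ} (hg : PolyGrowth g) (h : ∀ x, |f x| ≤ |g x|) :
    PolyGrowth f := by
  obtain ⟨C, q, hC⟩ := hg
  exact ⟨C, q, fun x => (h x).trans (hC x)⟩

lemma PolyGrowth.const (c : ℝ) : PolyGrowth (fun _ : ι → ℝ => c) := ⟨|c|, 0, by simp⟩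

lemma PolyGrowth.coord (e : ι) : PolyGrowth (fun x : ι → ℝ => x e) :=
  ⟨1, 1, fun x => by have := norm_le_pi_norm x e; simp at this ⊢; linarith⟩

lemma PolyGrowth.add {f g : (ι → ℝ) → ℝ} (hf : PolyGrowth f) (hg : PolyGrowth g) :
    PolyGrowth (fun x => f x + g x) := by
  obtain ⟨C, q, hC⟩ := hf
  obtain ⟨D, r, hD⟩ := hg
  refine ⟨|C| + |D|, q + r, fun x => ?_⟩
  have h1 : 1 ≤ 1 + ‖x‖ := by linarith [norm_nonneg x]
  have a : C * (1 + ‖x‖) ^ q ≤ |C| * (1 + ‖x‖) ^ (q + r) :=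
    mul_le_mul (le_abs_self C) (pow_le_pow_right₀ h1 (by omega)) (by positivity) (abs_nonneg _)
  have b : D * (1 + ‖x‖) ^ r ≤ |D| * (1 + ‖x‖) ^ (q + r) :=
    mul_le_mul (le_abs_self D) (pow_le_pow_right₀ h1 (by omega)) (by positivity) (abs_nonneg _)
  calc |f x + g x| ≤ |f x| + |g x| := abs_add_le _ _
    _ ≤ _ := by linarith [hC x, hD x]

lemma PolyGrowth.mul {f g : (ι → ℝ) → ℝ} (hf : PolyGrowth f) (hg : PolyGrowth g) :
    PolyGrowth (fun x => f x * g x) := by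
  obtain ⟨C, q, hC⟩ := hf
  obtain ⟨D, r, hD⟩ := hg
  refine ⟨C * D, q + r, fun x => ?_⟩
  rw [abs_mul, pow_add]
  calc |f x| * |g x| ≤ (C * (1 + ‖x‖) ^ q) * (D * (1 + ‖x‖) ^ r) :=
        mul_le_mul (hC x) (hD x) (abs_nonneg _) ((abs_nonneg _).trans (hC x))
    _ = _ := by ring

lemma PolyGrowth.abs {f : (ι → ℝ) → ℝ} (hf : PolyGrowth f) : PolyGrowth (fun x => |f x|) :=
  hf.mono fun x => by simp

lemma PolyGrowth.sum {κ : Type*} (s : Finset κ) {f : κ → (ι → ℝ) → ℝ}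
    (hf : ∀ k ∈ s, PolyGrowth (f k)) : PolyGrowth (fun x => ∑ k ∈ s, f k x) := by
  classical
  induction s using Finset.induction_on with
  | empty => simpa using PolyGrowth.const 0
  | insert a s ha ih =>
    simp only [Finset.sum_insert ha]
    exact (hf _ (Finset.mem_insert_self _ _)).add
      (ih fun k hk => hf k (Finset.mem_insert_of_mem hk))

instance isGaussian_stdPi : IsGaussian (stdPi ι) := by
  have h := map_pi_eq_stdGaussian (ι := ι)
  have h2 : (stdGaussian (EuclideanSpace ℝ ι)).map
      (EuclideanSpace.equiv ι ℝ : EuclideanSpace ℝ ι →L[ℝ] (ι → ℝ)) = stdPi ι := by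
    rw [← h, Measure.map_map (by fun_prop) (by fun_prop)]
    exact Measure.map_id
  rw [← h2]
  infer_instance

lemma PolyGrowth.integrable {f : (ι → ℝ) → ℝ} (hf : PolyGrowth f)
    (hm : AEStronglyMeasurable f (stdPi ι)) : Integrable f (stdPi ι) := by
  obtain ⟨C, q, hC⟩ := hf
  have h0 : MemLp (fun x : ι → ℝ => ‖x‖) (q : ℝ≥0∞) (stdPi ι) :=
    (IsGaussian.memLp_id (stdPi ι) q (ENNReal.natCast_ne_top q)).norm
  have h1 : MemLp (fun _ : ι → ℝ => (1 : ℝ)) (q : ℝ≥0∞) (stdPi ι) := memLp_const 1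
  have h2 : Integrable (fun x : ι → ℝ => ‖1 + ‖x‖‖ ^ q) (stdPi ι) := by
    by_cases hq : q = 0
    · subst hq; simp
    · exact (h1.add h0).integrable_norm_pow hq
  refine (h2.const_mul C).mono' hm (ae_of_all _ fun x => ?_)
  have h3 : ‖1 + ‖x‖‖ = 1 + ‖x‖ := Real.norm_of_nonneg (by positivity)
  rw [h3]
  exact hC x

lemma polyGrowth_eval (p : MvPolynomial ι ℝ) : PolyGrowth fun x => MvPolynomial.eval x p := by
  induction p using MvPolynomial.induction_on with
  | C a => simpa using PolyGrowth.const a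
  | add p q hp hq => simpa using hp.add hq
  | mul_X p i hp => simpa using hp.mul (PolyGrowth.coord i)

lemma integrable_eval_stdPi (p : MvPolynomial ι ℝ) :
    Integrable (fun x => MvPolynomial.eval x p) (stdPi ι) :=
  (polyGrowth_eval p).integrable (MvPolynomial.continuous_eval p).aestronglyMeasurable

lemma hasDerivAt_eval_update [DecidableEq ι] (p : MvPolynomial ι ℝ) (e : ι) (x : ι → ℝ) :
    HasDerivAt (fun t => MvPolynomial.eval (Function.update x e t) p)
      (MvPolynomial.eval x (MvPolynomial.pderiv e p)) (x e) := by
  induction p using MvPolynomial.induction_on with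
  | C a => simpa using hasDerivAt_const (x e) a
  | add p q hp hq => simpa using hp.fun_add hq
  | mul_X p i hp =>
    have hX : HasDerivAt (fun t => Function.update x e t i)
        (MvPolynomial.eval x (MvPolynomial.pderiv e (MvPolynomial.X i))) (x e) := by
      by_cases h : i = e
      · subst h; simpa using hasDerivAt_id' (x i)
      · simpa [Function.update_of_ne h, MvPolynomial.pderiv_X_of_ne h]
          using hasDerivAt_const (x e) (x i)
    have := hp.fun_mul hX
    simp only [map_mul, MvPolynomial.eval_X, MvPolynomial.pderiv_mul, map_add]
    refine this.congr_deriv ?_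
    simp

/-- The divergence (Skorokhod integral) `∑ₑ (xₑ uₑ - ∂ₑ uₑ)` of a polynomial vector field, the
adjoint of the gradient in the Gaussian space. -/
noncomputable def gaussDiv (u : ι → MvPolynomial ι ℝ) : MvPolynomial ι ℝ :=
  ∑ e, (MvPolynomial.X e * u e - MvPolynomial.pderiv e (u e))

/-- Adjointness of `gaussDiv` and the gradient. -/
lemma integral_gaussDiv_mul [DecidableEq ι] (u : ι → MvPolynomial ι ℝ) {h : (ι → ℝ) → ℝ}
    {h' : ι → (ι → ℝ) → ℝ} (hh : Continuous h) (hh' : ∀ e, Continuous (h' e))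
    (gh : PolyGrowth h) (gh' : ∀ e, PolyGrowth (h' e))
    (hd : ∀ e x, HasDerivAt (fun t => h (Function.update x e t)) (h' e x) (x e)) :
    ∫ x, MvPolynomial.eval x (gaussDiv u) * h x ∂(stdPi ι)
      = ∫ x, ∑ e, MvPolynomial.eval x (u e) * h' e x ∂(stdPi ι) := by
  have c (p : MvPolynomial ι ℝ) : Continuous fun x => MvPolynomial.eval x p :=
    MvPolynomial.continuous_eval p
  have I1 (p : MvPolynomial ι ℝ) : Integrable (fun x => MvPolynomial.eval x p * h x) (stdPi ι) :=
    ((polyGrowth_eval p).mul gh).integrable ((c p).mul hh).aestronglyMeasurable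
  have I2 (p : MvPolynomial ι ℝ) (e) :
      Integrable (fun x => MvPolynomial.eval x p * h' e x) (stdPi ι) :=
    ((polyGrowth_eval p).mul (gh' e)).integrable ((c p).mul (hh' e)).aestronglyMeasurable
  have I3 (e) : Integrable (fun x : ι → ℝ => x e * (MvPolynomial.eval x (u e) * h x))
      (stdPi ι) := by
    refine (I1 (MvPolynomial.X e * u e)).congr (ae_of_all _ fun x => ?_)
    simp only [map_mul, MvPolynomial.eval_X]
    ring
  have key (e : ι) : ∫ x, x e * (MvPolynomial.eval x (u e) * h x) ∂(stdPi ι)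
      = ∫ x, (MvPolynomial.eval x (MvPolynomial.pderiv e (u e)) * h x
          + MvPolynomial.eval x (u e) * h' e x) ∂(stdPi ι) := by
    refine integral_coord_mul_stdPi e (fun x => ?_) (I1 _) (I3 e) ((I1 _).add (I2 _ e))
    have := (hasDerivAt_eval_update (u e) e x).fun_mul (hd e x)
    simpa using this
  calc ∫ x, MvPolynomial.eval x (gaussDiv u) * h x ∂(stdPi ι)
      = ∫ x, ∑ e, (x e * (MvPolynomial.eval x (u e) * h x)
          - MvPolynomial.eval x (MvPolynomial.pderiv e (u e)) * h x) ∂(stdPi ι) := by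
        congr 1; ext x
        simp only [gaussDiv, map_sum, map_sub, map_mul, MvPolynomial.eval_X, Finset.sum_mul]
        exact Finset.sum_congr rfl fun e _ => by ring
    _ = ∑ e, (∫ x, x e * (MvPolynomial.eval x (u e) * h x) ∂(stdPi ι)
          - ∫ x, MvPolynomial.eval x (MvPolynomial.pderiv e (u e)) * h x ∂(stdPi ι)) := by
        refine (integral_finsetSum _ fun e _ =>
          (I3 e).sub (I1 (MvPolynomial.pderiv e (u e)))).trans ?_
        exact Finset.sum_congr rfl fun e _ => integral_sub (I3 e) (I1 _)
    _ = ∑ e, ∫ x, MvPolynomial.eval x (u e) * h' e x ∂(stdPi ι) := by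
        refine Finset.sum_congr rfl fun e _ => ?_
        rw [key, integral_add (I1 _) (I2 _ e)]; ring
    _ = _ := (integral_finsetSum _ fun e _ => I2 _ e).symm

end PolyGrowth

/-! ### Comparison with a Gaussian vector through the Stein matrix -/

section Interpolation

set_option linter.unusedSectionVars false

variable {d : ℕ} {σ : Type*} [Fintype σ] [DecidableEq σ]

/-- Evaluation of a finite family of polynomials as a vector of a Euclidean space. -/
noncomputable def evalVec (F : Fin d → MvPolynomial σ ℝ) (x : σ → ℝ) : EuclideanSpace ℝ (Fin d) :=
  WithLp.toLp 2 fun k => MvPolynomial.eval x (F k)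

lemma continuous_evalVec (F : Fin d → MvPolynomial σ ℝ) : Continuous (evalVec F) :=
  (PiLp.continuous_toLp 2 _).comp (continuous_pi fun k => MvPolynomial.continuous_eval (F k))

lemma euclidean_norm_le_sum (v : EuclideanSpace ℝ (Fin d)) : ‖v‖ ≤ ∑ k, |v k| := by
  have h : v = ∑ k, v k • EuclideanSpace.single k (1 : ℝ) := by
    ext i; simp [Finset.sum_apply, Pi.single_apply]
  calc ‖v‖ = ‖∑ k, v k • EuclideanSpace.single k (1 : ℝ)‖ := by rw [← h]
    _ ≤ ∑ k, ‖v k • EuclideanSpace.single k (1 : ℝ)‖ := norm_sum_le _ _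
    _ = _ := by simp [norm_smul]

lemma polyGrowth_norm_evalVec (F : Fin d → MvPolynomial σ ℝ) :
    PolyGrowth fun x => ‖evalVec F x‖ := by
  refine (PolyGrowth.sum Finset.univ fun k _ => (polyGrowth_eval (F k)).abs).mono fun x => ?_
  rw [abs_of_nonneg (norm_nonneg _), abs_of_nonneg (Finset.sum_nonneg fun k _ => abs_nonneg _)]
  exact euclidean_norm_le_sum _

lemma hasDerivAt_evalVec_update (F : Fin d → MvPolynomial σ ℝ) (e : σ) (x : σ → ℝ) :
    HasDerivAt (fun t => evalVec F (Function.update x e t))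
      (evalVec (fun k => MvPolynomial.pderiv e (F k)) x) (x e) := by
  have h := hasDerivAt_pi.2 fun k => hasDerivAt_eval_update (F k) e x
  exact (PiLp.hasFDerivAt_toLp 2 _).comp_hasDerivAt _ h

variable {g : EuclideanSpace ℝ (Fin d) → ℝ} {M : ℝ}

lemma norm_fderiv_fderiv_le (hM : ∀ y, ‖iteratedFDeriv ℝ 2 g y‖ ≤ M)
    (y : EuclideanSpace ℝ (Fin d)) : ‖fderiv ℝ (fderiv ℝ g) y‖ ≤ M := by
  refine le_trans (le_of_eq ?_) (hM y)
  rw [← norm_iteratedFDeriv_fderiv (n := 1), norm_iteratedFDeriv_one]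

lemma norm_fderiv_le_of_iteratedFDeriv_two_le (hg : ContDiff ℝ 3 g)
    (hM : ∀ y, ‖iteratedFDeriv ℝ 2 g y‖ ≤ M) (y : EuclideanSpace ℝ (Fin d)) :
    ‖fderiv ℝ g y‖ ≤ ‖fderiv ℝ g 0‖ + M * ‖y‖ := by
  have hg1 : ContDiff ℝ 2 (fderiv ℝ g) := hg.fderiv_right (by norm_num)
  have h := Convex.norm_image_sub_le_of_norm_fderiv_le (𝕜 := ℝ) (f := fderiv ℝ g) (s := Set.univ)
    (fun x _ => (hg1.differentiable (by norm_num)) x) (fun x _ => norm_fderiv_fderiv_le hM x)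
    convex_univ (Set.mem_univ 0) (Set.mem_univ y)
  rw [sub_zero] at h
  calc ‖fderiv ℝ g y‖ = ‖fderiv ℝ g 0 + (fderiv ℝ g y - fderiv ℝ g 0)‖ := by congr 1; abel
    _ ≤ _ := (norm_add_le _ _).trans (by linarith)

lemma abs_le_of_iteratedFDeriv_two_le (hg : ContDiff ℝ 3 g)
    (hM : ∀ y, ‖iteratedFDeriv ℝ 2 g y‖ ≤ M) (y : EuclideanSpace ℝ (Fin d)) :
    |g y| ≤ |g 0| + (‖fderiv ℝ g 0‖ + M * ‖y‖) * ‖y‖ := by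
  have hM0 : 0 ≤ M := (norm_nonneg _).trans (hM 0)
  have h := Convex.norm_image_sub_le_of_norm_fderiv_le (𝕜 := ℝ) (f := g)
    (s := Metric.closedBall 0 ‖y‖) (C := ‖fderiv ℝ g 0‖ + M * ‖y‖)
    (fun x _ => (hg.differentiable (by norm_num)) x)
    (fun x hx => (norm_fderiv_le_of_iteratedFDeriv_two_le hg hM x).trans (by
      have : ‖x‖ ≤ ‖y‖ := by simpa using hx
      gcongr))
    (convex_closedBall _ _) (x := 0) (y := y) (by simp) (by simp)
  rw [sub_zero, Real.norm_eq_abs] at h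
  calc |g y| = |g 0 + (g y - g 0)| := by congr 1; ring
    _ ≤ _ := (abs_add_le _ _).trans (by linarith)

lemma integrable_comp_evalVec (hg : ContDiff ℝ 3 g) (hM : ∀ y, ‖iteratedFDeriv ℝ 2 g y‖ ≤ M)
    (F : Fin d → MvPolynomial σ ℝ) : Integrable (fun x => g (evalVec F x)) (stdPi σ) := by
  refine PolyGrowth.integrable ?_ (hg.continuous.comp (continuous_evalVec F)).aestronglyMeasurable
  have h := polyGrowth_norm_evalVec F
  refine ((PolyGrowth.const |g 0|).add (((PolyGrowth.const ‖fderiv ℝ g 0‖).add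
    ((PolyGrowth.const M).mul h)).mul h)).mono fun x => ?_
  exact (abs_le_of_iteratedFDeriv_two_le hg hM _).trans (le_abs_self _)

/-- Gaussian integration by parts against a partial derivative of `g`, evaluated at a polynomial
random vector `W`. -/
lemma integral_gaussDiv_mul_fderiv (hg : ContDiff ℝ 3 g) (hM : ∀ y, ‖iteratedFDeriv ℝ 2 g y‖ ≤ M)
    (W : Fin d → MvPolynomial σ ℝ) (u : σ → MvPolynomial σ ℝ) (v : EuclideanSpace ℝ (Fin d)) :
    ∫ x, MvPolynomial.eval x (gaussDiv u) * fderiv ℝ g (evalVec W x) v ∂(stdPi σ)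
      = ∫ x, fderiv ℝ (fderiv ℝ g) (evalVec W x)
          (evalVec (fun l => ∑ e, u e * MvPolynomial.pderiv e (W l)) x) v ∂(stdPi σ) := by
  have hg1 : ContDiff ℝ 2 (fderiv ℝ g) := hg.fderiv_right (by norm_num)
  have hg2 : ContDiff ℝ 1 (fderiv ℝ (fderiv ℝ g)) := hg1.fderiv_right (by norm_num)
  have cW := continuous_evalVec W
  have gW := polyGrowth_norm_evalVec W
  have cD : ∀ e, Continuous (evalVec fun l => MvPolynomial.pderiv e (W l)) :=
    fun e => continuous_evalVec _
  rw [integral_gaussDiv_mul u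
    (h' := fun e x => fderiv ℝ (fderiv ℝ g) (evalVec W x)
      (evalVec (fun l => MvPolynomial.pderiv e (W l)) x) v)]
  · congr 1
    ext x
    have : evalVec (fun l => ∑ e, u e * MvPolynomial.pderiv e (W l)) x
        = ∑ e, MvPolynomial.eval x (u e) • evalVec (fun l => MvPolynomial.pderiv e (W l)) x := by
      ext l; simp [evalVec, Finset.sum_apply]
    rw [this, map_sum, _root_.sum_apply]
    simp
  · exact (hg1.continuous.comp cW).clm_apply continuous_const
  · exact fun e => ((hg2.continuous.comp cW).clm_apply (cD e)).clm_apply continuous_const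
  · refine (((PolyGrowth.const ‖fderiv ℝ g 0‖).add ((PolyGrowth.const M).mul gW)).mul
      (PolyGrowth.const ‖v‖)).mono fun x => ?_
    refine le_trans ?_ (le_abs_self _)
    refine ((fderiv ℝ g (evalVec W x)).le_opNorm v).trans ?_
    gcongr
    exact norm_fderiv_le_of_iteratedFDeriv_two_le hg hM _
  · refine fun e => (((PolyGrowth.const M).mul (polyGrowth_norm_evalVec
      fun l => MvPolynomial.pderiv e (W l))).mul (PolyGrowth.const ‖v‖)).mono fun x => ?_
    refine le_trans ?_ (le_abs_self _)
    refine ((fderiv ℝ (fderiv ℝ g) (evalVec W x) _).le_opNorm v).trans ?_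
    gcongr
    refine ((fderiv ℝ (fderiv ℝ g) (evalVec W x)).le_opNorm _).trans ?_
    gcongr
    exact norm_fderiv_fderiv_le hM _
  · intro e x
    have h1 : HasFDerivAt (fderiv ℝ g) (fderiv ℝ (fderiv ℝ g) (evalVec W x)) (evalVec W x) :=
      ((hg1.differentiable (by norm_num)) _).hasFDerivAt
    have h1' : HasFDerivAt (fderiv ℝ g) (fderiv ℝ (fderiv ℝ g) (evalVec W x))
        (evalVec W (Function.update x e (x e))) := by simpa using h1
    have h2 := h1'.comp_hasDerivAt (x e) (hasDerivAt_evalVec_update W e x)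
    have h3 := h2.clm_apply (hasDerivAt_const (x e) v)
    simpa using h3

/-- The rotation `cos θ Z + sin θ F` that interpolates between `Z` and `F`. -/
noncomputable def rotPoly (F Z : Fin d → MvPolynomial σ ℝ) (θ : ℝ) (k : Fin d) :
    MvPolynomial σ ℝ :=
  MvPolynomial.C (Real.cos θ) * Z k + MvPolynomial.C (Real.sin θ) * F k

lemma evalVec_rotPoly (F Z : Fin d → MvPolynomial σ ℝ) (θ : ℝ) (x : σ → ℝ) :
    evalVec (rotPoly F Z θ) x = Real.cos θ • evalVec Z x + Real.sin θ • evalVec F x := by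
  ext k; simp [evalVec, rotPoly]

/-- Differentiation of the interpolation under the expectation. -/
lemma hasDerivAt_integral_rotPoly (hg : ContDiff ℝ 3 g)
    (hM : ∀ y, ‖iteratedFDeriv ℝ 2 g y‖ ≤ M) (F Z : Fin d → MvPolynomial σ ℝ) (θ : ℝ) :
    Integrable (fun x => fderiv ℝ g (evalVec (rotPoly F Z θ) x)
        (-Real.sin θ • evalVec Z x + Real.cos θ • evalVec F x)) (stdPi σ) ∧
    HasDerivAt (fun θ => ∫ x, g (evalVec (rotPoly F Z θ) x) ∂(stdPi σ))
      (∫ x, fderiv ℝ g (evalVec (rotPoly F Z θ) x)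
        (-Real.sin θ • evalVec Z x + Real.cos θ • evalVec F x) ∂(stdPi σ)) θ := by
  have hM0 : 0 ≤ M := (norm_nonneg _).trans (hM 0)
  have hg1 : ContDiff ℝ 2 (fderiv ℝ g) := hg.fderiv_right (by norm_num)
  have cF := continuous_evalVec F
  have cZ := continuous_evalVec Z
  have gS := (polyGrowth_norm_evalVec Z).add (polyGrowth_norm_evalVec F)
  have gB : PolyGrowth (fun x => (‖fderiv ℝ g 0‖ + M * (‖evalVec Z x‖ + ‖evalVec F x‖))
      * (‖evalVec Z x‖ + ‖evalVec F x‖)) :=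
    ((PolyGrowth.const _).add ((PolyGrowth.const M).mul gS)).mul gS
  have nb : ∀ (a b : ℝ), |a| ≤ 1 → |b| ≤ 1 → ∀ x,
      ‖a • evalVec Z x + b • evalVec F x‖ ≤ ‖evalVec Z x‖ + ‖evalVec F x‖ := by
    intro a b ha hb x
    refine (norm_add_le _ _).trans ?_
    rw [norm_smul, norm_smul, Real.norm_eq_abs, Real.norm_eq_abs]
    have h1 := norm_nonneg (evalVec Z x)
    have h2 := norm_nonneg (evalVec F x)
    nlinarith
  refine hasDerivAt_integral_of_dominated_loc_of_deriv_le (s := Set.univ) (μ := stdPi σ) (𝕜 := ℝ)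
    (F := fun θ x => g (evalVec (rotPoly F Z θ) x))
    (F' := fun θ x => fderiv ℝ g (evalVec (rotPoly F Z θ) x)
        (-Real.sin θ • evalVec Z x + Real.cos θ • evalVec F x))
    (bound := fun x => (‖fderiv ℝ g 0‖ + M * (‖evalVec Z x‖ + ‖evalVec F x‖))
      * (‖evalVec Z x‖ + ‖evalVec F x‖)) Filter.univ_mem
    (Filter.Eventually.of_forall fun θ =>
      (hg.continuous.comp (continuous_evalVec _)).aestronglyMeasurable)
    (integrable_comp_evalVec hg hM _) ?_ ?_ (gB.integrable ?_) ?_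
  · refine Continuous.aestronglyMeasurable ?_
    exact (hg1.continuous.comp (continuous_evalVec _)).clm_apply (by fun_prop)
  · refine ae_of_all _ fun x θ _ => ?_
    refine ((fderiv ℝ g (evalVec (rotPoly F Z θ) x)).le_opNorm _).trans ?_
    have h1 := norm_fderiv_le_of_iteratedFDeriv_two_le hg hM (evalVec (rotPoly F Z θ) x)
    rw [evalVec_rotPoly] at h1 ⊢
    have h2 := nb _ _ (Real.abs_cos_le_one θ) (Real.abs_sin_le_one θ) x
    have h3 := nb (-Real.sin θ) (Real.cos θ) (by simpa using Real.abs_sin_le_one θ)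
      (Real.abs_cos_le_one θ) x
    refine mul_le_mul (h1.trans ?_) h3 (norm_nonneg _) (by positivity)
    gcongr
  · exact Continuous.aestronglyMeasurable (by fun_prop)
  · refine ae_of_all _ fun x θ _ => ?_
    have h1 : HasDerivAt (fun θ => evalVec (rotPoly F Z θ) x)
        (-Real.sin θ • evalVec Z x + Real.cos θ • evalVec F x) θ := by
      simp only [evalVec_rotPoly]
      exact ((Real.hasDerivAt_cos θ).smul_const _).add ((Real.hasDerivAt_sin θ).smul_const _)
    exact ((hg.differentiable (by norm_num)) _).hasFDerivAt.comp_hasDerivAt θ h1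

/-- The polynomials `⟨u_k, ∇F_l⟩`, whose deviation from the identity matrix measures the distance
of the vector `F = div u` from a standard Gaussian. -/
noncomputable def steinMatrix (u : Fin d → σ → MvPolynomial σ ℝ) (F : Fin d → MvPolynomial σ ℝ)
    (k l : Fin d) : MvPolynomial σ ℝ :=
  ∑ e, u k e * MvPolynomial.pderiv e (F l)

/-- Gaussian comparison by smart-path interpolation: if `F = div u` and `Z = div w` is a standard
Gaussian vector independent of `F`, only the part `⟨u, ∇F⟩ - ⟨w, ∇Z⟩` of the Stein matrices is left
in the derivative along the rotation. -/
theorem abs_integral_sub_le_of_steinMatrix (hg : ContDiff ℝ 3 g)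
    (hM : ∀ y, ‖iteratedFDeriv ℝ 2 g y‖ ≤ M) (F Z : Fin d → MvPolynomial σ ℝ)
    (u w : Fin d → σ → MvPolynomial σ ℝ) (hF : ∀ k, F k = gaussDiv (u k))
    (hZ : ∀ k, Z k = gaussDiv (w k)) (hFZ : ∀ k l, steinMatrix u Z k l = 0)
    (hZF : ∀ k l, steinMatrix w F k l = 0)
    (hZZ : ∀ k l, steinMatrix w Z k l = if k = l then 1 else 0) :
    |∫ x, g (evalVec F x) ∂(stdPi σ) - ∫ x, g (evalVec Z x) ∂(stdPi σ)|
      ≤ M * ∑ k, ∑ l, ∫ x, |MvPolynomial.eval x (steinMatrix u F k l)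
          - if k = l then 1 else 0| ∂(stdPi σ) := by
  have hM0 : 0 ≤ M := (norm_nonneg _).trans (hM 0)
  set S := ∑ k, ∑ l, ∫ x, |MvPolynomial.eval x (steinMatrix u F k l)
          - if k = l then 1 else 0| ∂(stdPi σ) with hS
  have hS0 : 0 ≤ S := Finset.sum_nonneg fun k _ => Finset.sum_nonneg fun l _ =>
    integral_nonneg fun x => abs_nonneg _
  have hg1 : ContDiff ℝ 2 (fderiv ℝ g) := hg.fderiv_right (by norm_num)
  have hg2 : ContDiff ℝ 1 (fderiv ℝ (fderiv ℝ g)) := hg1.fderiv_right (by norm_num)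
  let E (k : Fin d) : EuclideanSpace ℝ (Fin d) := EuclideanSpace.single k 1
  have hdec (v : EuclideanSpace ℝ (Fin d)) : v = ∑ k, v k • E k := by
    ext i; simp [E, Finset.sum_apply, Pi.single_apply]
  have hbound (θ : ℝ) : ‖∫ x, fderiv ℝ g (evalVec (rotPoly F Z θ) x)
        (-Real.sin θ • evalVec Z x + Real.cos θ • evalVec F x) ∂(stdPi σ)‖ ≤ M * S / 2 := by
    set W := rotPoly F Z θ with hW
    have gW := polyGrowth_norm_evalVec W
    have I1 (p : MvPolynomial σ ℝ) (k : Fin d) :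
        Integrable (fun x => MvPolynomial.eval x p * fderiv ℝ g (evalVec W x) (E k)) (stdPi σ) := by
      refine PolyGrowth.integrable (((polyGrowth_eval p).abs.mul (((PolyGrowth.const
        ‖fderiv ℝ g 0‖).add ((PolyGrowth.const M).mul gW)).mul
        (PolyGrowth.const ‖E k‖))).mono fun x => ?_) (Continuous.aestronglyMeasurable ?_)
      · refine le_trans ?_ (le_abs_self _)
        rw [abs_mul]
        gcongr
        refine ((fderiv ℝ g (evalVec W x)).le_opNorm _).trans ?_
        gcongr
        exact norm_fderiv_le_of_iteratedFDeriv_two_le hg hM _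
      · exact (MvPolynomial.continuous_eval p).mul
          ((hg1.continuous.comp (continuous_evalVec W)).clm_apply continuous_const)
    have I2 (Γ : Fin d → MvPolynomial σ ℝ) (k : Fin d) :
        Integrable (fun x => fderiv ℝ (fderiv ℝ g) (evalVec W x) (evalVec Γ x) (E k)) (stdPi σ) := by
      refine PolyGrowth.integrable (((PolyGrowth.const M).mul ((polyGrowth_norm_evalVec Γ).mul
        (PolyGrowth.const ‖E k‖))).mono fun x => ?_) (Continuous.aestronglyMeasurable ?_)
      · refine le_trans ?_ (le_abs_self _)
        refine (ContinuousLinearMap.le_opNorm₂ (fderiv ℝ (fderiv ℝ g) (evalVec W x)) _ _).trans ?_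
        rw [mul_assoc]
        gcongr
        exact norm_fderiv_fderiv_le hM _
      · exact ((hg2.continuous.comp (continuous_evalVec W)).clm_apply
          (continuous_evalVec _)).clm_apply continuous_const
    have e1 (k : Fin d) (x : σ → ℝ) :
        evalVec (fun l => ∑ e, u k e * MvPolynomial.pderiv e (W l)) x
          = Real.sin θ • evalVec (steinMatrix u F k) x := by
      ext l
      have h1 : ∑ e, u k e * MvPolynomial.pderiv e (W l)
          = MvPolynomial.C (Real.cos θ) * steinMatrix u Z k l
            + MvPolynomial.C (Real.sin θ) * steinMatrix u F k l := by
        simp only [hW, rotPoly, steinMatrix, map_add, MvPolynomial.pderiv_C_mul, Finset.mul_sum,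
          ← Finset.sum_add_distrib]
        exact Finset.sum_congr rfl fun e _ => by ring
      simp only [evalVec, h1, hFZ]
      simp
    have e2 (k : Fin d) (x : σ → ℝ) :
        evalVec (fun l => ∑ e, w k e * MvPolynomial.pderiv e (W l)) x = Real.cos θ • E k := by
      ext l
      have h1 : ∑ e, w k e * MvPolynomial.pderiv e (W l)
          = MvPolynomial.C (Real.cos θ) * steinMatrix w Z k l
            + MvPolynomial.C (Real.sin θ) * steinMatrix w F k l := by
        simp only [hW, rotPoly, steinMatrix, map_add, MvPolynomial.pderiv_C_mul, Finset.mul_sum,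
          ← Finset.sum_add_distrib]
        exact Finset.sum_congr rfl fun e _ => by ring
      by_cases hkl : k = l
      · subst hkl
        simp only [evalVec, h1, hZF, hZZ]
        simp [E]
      · simp only [evalVec, h1, hZF, hZZ]
        simp [E, hkl, Ne.symm hkl]
    have key : ∫ x, fderiv ℝ g (evalVec W x)
        (-Real.sin θ • evalVec Z x + Real.cos θ • evalVec F x) ∂(stdPi σ)
        = Real.sin θ * Real.cos θ * ∑ k, ∫ x, fderiv ℝ (fderiv ℝ g) (evalVec W x)
          (evalVec (steinMatrix u F k) x - E k) (E k) ∂(stdPi σ) := by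
      have a1 (k : Fin d) : ∫ x, MvPolynomial.eval x (F k) * fderiv ℝ g (evalVec W x) (E k) ∂(stdPi σ)
          = Real.sin θ * ∫ x, fderiv ℝ (fderiv ℝ g) (evalVec W x)
            (evalVec (steinMatrix u F k) x) (E k) ∂(stdPi σ) := by
        rw [hF k, integral_gaussDiv_mul_fderiv hg hM, ← integral_const_mul]
        simp only [e1, map_smul, _root_.smul_apply, smul_eq_mul]
      have a2 (k : Fin d) : ∫ x, MvPolynomial.eval x (Z k) * fderiv ℝ g (evalVec W x) (E k) ∂(stdPi σ)
          = Real.cos θ * ∫ x, fderiv ℝ (fderiv ℝ g) (evalVec W x) (E k) (E k) ∂(stdPi σ) := by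
        rw [hZ k, integral_gaussDiv_mul_fderiv hg hM, ← integral_const_mul]
        simp only [e2, map_smul, _root_.smul_apply, smul_eq_mul]
      have I3 (k : Fin d) : Integrable (fun x => fderiv ℝ (fderiv ℝ g) (evalVec W x) (E k) (E k))
          (stdPi σ) := by
        refine (I2 (fun l => if l = k then 1 else 0) k).congr (ae_of_all _ fun x => ?_)
        have : evalVec (fun l => if l = k then (1 : MvPolynomial σ ℝ) else 0) x = E k := by
          ext l; by_cases h : l = k <;> simp [evalVec, E, h]
        simp only [this]
      calc _ = ∫ x, ∑ k, (-Real.sin θ * (MvPolynomial.eval x (Z k) * fderiv ℝ g (evalVec W x) (E k))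
            + Real.cos θ * (MvPolynomial.eval x (F k) * fderiv ℝ g (evalVec W x) (E k)))
            ∂(stdPi σ) := by
            congr 1; ext x
            rw [hdec (-Real.sin θ • evalVec Z x + Real.cos θ • evalVec F x), map_sum]
            refine Finset.sum_congr rfl fun k _ => ?_
            simp [evalVec]; ring
        _ = ∑ k, (-Real.sin θ * ∫ x, MvPolynomial.eval x (Z k) * fderiv ℝ g (evalVec W x) (E k)
              ∂(stdPi σ)
            + Real.cos θ * ∫ x, MvPolynomial.eval x (F k) * fderiv ℝ g (evalVec W x) (E k)
            ∂(stdPi σ)) := by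
            refine (integral_finsetSum _ fun k _ => ((I1 (Z k) k).const_mul (-Real.sin θ)).add
              ((I1 (F k) k).const_mul (Real.cos θ))).trans ?_
            refine Finset.sum_congr rfl fun k _ => ?_
            rw [← integral_const_mul, ← integral_const_mul]
            exact integral_add ((I1 (Z k) k).const_mul _) ((I1 (F k) k).const_mul _)
        _ = _ := by
            rw [Finset.mul_sum]
            refine Finset.sum_congr rfl fun k _ => ?_
            simp only [map_sub, _root_.sub_apply]
            rw [a1, a2, integral_sub (I2 _ k) (I3 k)]
            ring
    rw [key, norm_mul, Real.norm_eq_abs]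
    -- a factor `1 / 2` from the double angle, which makes up for the length `π / 2 ≤ 2` of the arc
    have hsc : |Real.sin θ * Real.cos θ| ≤ 1 / 2 := by
      rw [abs_le]
      constructor <;> nlinarith [Real.sin_sq_add_cos_sq θ, sq_nonneg (Real.sin θ + Real.cos θ),
        sq_nonneg (Real.sin θ - Real.cos θ)]
    have hsum : ‖∑ k, ∫ x, fderiv ℝ (fderiv ℝ g) (evalVec W x)
          (evalVec (steinMatrix u F k) x - E k) (E k) ∂(stdPi σ)‖ ≤ M * S := by
      refine (norm_sum_le _ _).trans ?_
      rw [hS, Finset.mul_sum]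
      refine Finset.sum_le_sum fun k _ => ?_
      have I4 (l : Fin d) : Integrable (fun x => |MvPolynomial.eval x (steinMatrix u F k l)
          - if k = l then 1 else 0|) (stdPi σ) :=
        ((integrable_eval_stdPi _).sub (integrable_const _)).abs
      rw [← integral_finsetSum _ fun l _ => I4 l, ← integral_const_mul]
      refine norm_integral_le_of_norm_le ((integrable_finsetSum _ fun l _ => I4 l).const_mul M)
        (ae_of_all _ fun x => ?_)
      refine (ContinuousLinearMap.le_opNorm₂ _ _ _).trans ?_
      have : ‖E k‖ = 1 := by simp [E]
      rw [this, mul_one]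
      refine mul_le_mul (norm_fderiv_fderiv_le hM _) ?_ (norm_nonneg _) hM0
      refine (euclidean_norm_le_sum _).trans (le_of_eq (Finset.sum_congr rfl fun l _ => ?_))
      simp [evalVec, E, eq_comm]
    have := mul_le_mul hsc hsum (norm_nonneg _) (by norm_num)
    linarith
  have hmv := norm_image_sub_le_of_norm_deriv_le_segment' (a := 0) (b := Real.pi / 2)
    (f := fun θ => ∫ x, g (evalVec (rotPoly F Z θ) x) ∂(stdPi σ)) (C := M * S / 2)
    (fun θ _ => (hasDerivAt_integral_rotPoly hg hM F Z θ).2.hasDerivWithinAt)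
    (fun θ _ => hbound θ) (Real.pi / 2) ⟨by positivity, le_rfl⟩
  have h0 : ∀ x, evalVec (rotPoly F Z 0) x = evalVec Z x := fun x => by simp [evalVec_rotPoly]
  have h1 : ∀ x, evalVec (rotPoly F Z (Real.pi / 2)) x = evalVec F x :=
    fun x => by simp [evalVec_rotPoly]
  simp only [h0, h1, Real.norm_eq_abs] at hmv
  refine hmv.trans ?_
  have := mul_nonneg hM0 hS0
  nlinarith [Real.pi_le_four, Real.pi_pos]

end Interpolation

section Comparison

variable {d : ℕ} {ι : Type*} [Fintype ι] [DecidableEq ι]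

set_option linter.unusedSectionVars false

/-- Restricting a standard Gaussian family along an injection of the index sets. -/
lemma map_comp_stdPi {κ : Type*} [Fintype κ] (f : κ → ι) (hf : Function.Injective f) :
    (stdPi ι).map (fun x => x ∘ f) = stdPi κ := by
  have h1 : iIndepFun (fun (i : ι) (x : ι → ℝ) => x i) (stdPi ι) :=
    iIndepFun_pi (X := fun _ => id) fun _ => aemeasurable_id
  have h2 := h1.precomp hf
  rw [iIndepFun_iff_map_fun_eq_pi_map (fun i => (measurable_pi_apply (f i)).aemeasurable)] at h2
  have h3 : ∀ i, (stdPi ι).map (fun x : ι → ℝ => x (f i)) = gaussianReal 0 1 := fun i =>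
    (measurePreserving_eval (fun _ : ι => gaussianReal 0 1) (f i)).map_eq
  simp only [h3] at h2
  exact h2

lemma pderiv_rename_of_notMem {τ : Type*} (f : ι → τ) (p : MvPolynomial ι ℝ) (e : τ)
    (he : ∀ i, f i ≠ e) : MvPolynomial.pderiv e (MvPolynomial.rename f p) = 0 := by
  induction p using MvPolynomial.induction_on with
  | C a => simp
  | add p q hp hq => simp [hp, hq]
  | mul_X p i hp => simp [hp, MvPolynomial.pderiv_X_of_ne (he i)]

lemma integral_comp_stdPi {κ : Type*} [Fintype κ] (f : κ → ι) (hf : Function.Injective f)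
    {h : (κ → ℝ) → ℝ} (hh : Continuous h) :
    ∫ x, h (x ∘ f) ∂(stdPi ι) = ∫ x, h x ∂(stdPi κ) := by
  have hm : Measurable fun x : ι → ℝ => x ∘ f :=
    measurable_pi_lambda _ fun i => measurable_pi_apply (f i)
  rw [← map_comp_stdPi f hf, integral_map hm.aemeasurable hh.aestronglyMeasurable]

/-- Comparison of a polynomial vector `F = div u` of independent standard Gaussians with a
standard Gaussian vector. -/
theorem abs_integral_sub_stdGaussian_le {g : EuclideanSpace ℝ (Fin d) → ℝ} {M : ℝ}
    (hg : ContDiff ℝ 3 g) (hM : ∀ y, ‖iteratedFDeriv ℝ 2 g y‖ ≤ M) (F : Fin d → MvPolynomial ι ℝ)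
    (u : Fin d → ι → MvPolynomial ι ℝ) (hF : ∀ k, F k = gaussDiv (u k)) :
    |∫ x, g (evalVec F x) ∂(stdPi ι) - ∫ z, g z ∂(stdGaussian (EuclideanSpace ℝ (Fin d)))|
      ≤ M * ∑ k, ∑ l, ∫ x, |MvPolynomial.eval x (steinMatrix u F k l)
          - if k = l then 1 else 0| ∂(stdPi ι) := by
  -- the auxiliary Gaussian vector is realized by the extra coordinates `Fin d` of `ι ⊕ Fin d`
  let F' : Fin d → MvPolynomial (ι ⊕ Fin d) ℝ := fun k => MvPolynomial.rename Sum.inl (F k)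
  let u' : Fin d → ι ⊕ Fin d → MvPolynomial (ι ⊕ Fin d) ℝ := fun k =>
    Sum.elim (fun e => MvPolynomial.rename Sum.inl (u k e)) fun _ => 0
  let Z : Fin d → MvPolynomial (ι ⊕ Fin d) ℝ := fun k => MvPolynomial.X (Sum.inr k)
  let w : Fin d → ι ⊕ Fin d → MvPolynomial (ι ⊕ Fin d) ℝ := fun k e =>
    if e = Sum.inr k then 1 else 0
  have pinl (e : ι) (p : MvPolynomial ι ℝ) :
      MvPolynomial.pderiv (Sum.inl e : ι ⊕ Fin d) (MvPolynomial.rename Sum.inl p)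
        = MvPolynomial.rename Sum.inl (MvPolynomial.pderiv e p) :=
    MvPolynomial.pderiv_rename Sum.inl_injective e p
  have hF' : ∀ k, F' k = gaussDiv (u' k) := fun k => by
    simp [F', u', gaussDiv, hF k, pinl]
  have hZ : ∀ k, Z k = gaussDiv (w k) := fun k => by
    have : ∀ e : ι ⊕ Fin d, MvPolynomial.pderiv e (w k e) = 0 := fun e => by
      by_cases h : e = Sum.inr k <;> simp [w, h]
    simp only [gaussDiv, this, sub_zero]
    simp [w, Z]
  have hS : ∀ k l, steinMatrix u' F' k l = MvPolynomial.rename Sum.inl (steinMatrix u F k l) :=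
    fun k l => by simp [steinMatrix, u', F', pinl]
  have main := abs_integral_sub_le_of_steinMatrix hg hM F' Z u' w hF' hZ
    (fun k l => by simp [steinMatrix, u', Z])
    (fun k l => by
      simp only [steinMatrix, w, F', ite_mul, one_mul, zero_mul, Finset.sum_ite_eq',
        Finset.mem_univ, if_true]
      exact pderiv_rename_of_notMem _ _ _ (by simp))
    (fun k l => by
      simp only [steinMatrix, w, Z, ite_mul, one_mul, zero_mul, Finset.sum_ite_eq',
        Finset.mem_univ, if_true]
      by_cases h : k = l
      · subst h; simp
      · rw [MvPolynomial.pderiv_X_of_ne (by simpa using Ne.symm h), if_neg h])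
  have t1 : ∫ x, g (evalVec F' x) ∂(stdPi (ι ⊕ Fin d)) = ∫ x, g (evalVec F x) ∂(stdPi ι) := by
    refine Eq.trans ?_ (integral_comp_stdPi (Sum.inl : ι → ι ⊕ Fin d) Sum.inl_injective
      (hg.continuous.comp (continuous_evalVec F)))
    simp [evalVec, F', MvPolynomial.eval_rename]
  have t2 : ∫ x, g (evalVec Z x) ∂(stdPi (ι ⊕ Fin d))
      = ∫ z, g z ∂(stdGaussian (EuclideanSpace ℝ (Fin d))) := by
    have hc : Continuous fun y : Fin d → ℝ => (WithLp.toLp 2 y : EuclideanSpace ℝ (Fin d)) :=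
      PiLp.continuous_toLp 2 _
    rw [← map_pi_eq_stdGaussian, integral_map (by fun_prop) hg.continuous.aestronglyMeasurable]
    refine Eq.trans ?_ (integral_comp_stdPi (Sum.inr : Fin d → ι ⊕ Fin d) Sum.inr_injective
      (hg.continuous.comp hc))
    simp [evalVec, Z, Function.comp_def]
  have t3 (k l : Fin d) : ∫ x, |MvPolynomial.eval x (steinMatrix u' F' k l)
        - if k = l then 1 else 0| ∂(stdPi (ι ⊕ Fin d))
      = ∫ x, |MvPolynomial.eval x (steinMatrix u F k l) - if k = l then 1 else 0| ∂(stdPi ι) := by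
    refine Eq.trans ?_ (integral_comp_stdPi (Sum.inl : ι → ι ⊕ Fin d) Sum.inl_injective
      (((MvPolynomial.continuous_eval (steinMatrix u F k l)).sub continuous_const).abs))
    simp [hS, MvPolynomial.eval_rename]
  simp only [t1, t2, t3] at main
  exact main

end Comparison

/-! ### Covariances of squarefree monomials -/

section Moments

variable {ι : Type*} [Fintype ι] [DecidableEq ι]

set_option linter.unusedSectionVars false

/-- The moments of the standard real Gaussian. -/
noncomputable def gaussMoment (q : ℕ) : ℝ := ∫ t, t ^ q ∂(gaussianReal 0 1)

lemma integrable_pow_gaussianReal (q : ℕ) : Integrable (fun t : ℝ => t ^ q) (gaussianReal 0 1) := by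
  by_cases hq : q = 0
  · subst hq; simp
  · have h := (memLp_id_gaussianReal (μ := 0) (v := 1) (q : NNReal)).integrable_norm_pow hq
    exact (integrable_norm_iff (by fun_prop)).1 (by simpa [norm_pow] using h)

lemma gaussMoment_zero : gaussMoment 0 = 1 := by simp [gaussMoment]

lemma gaussMoment_one : gaussMoment 1 = 0 := by simp [gaussMoment]

lemma gaussMoment_add_two (q : ℕ) : gaussMoment (q + 2) = (q + 1) * gaussMoment q := by
  have h := integral_id_mul_gaussianReal (f := fun t => t ^ (q + 1))
    (f' := fun t => ((q + 1 : ℕ) : ℝ) * t ^ q) (fun t => by simpa using hasDerivAt_pow (q + 1) t)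
    (integrable_pow_gaussianReal _)
    ((integrable_pow_gaussianReal (q + 2)).congr (ae_of_all _ fun t => by simp; ring))
    ((integrable_pow_gaussianReal q).const_mul _)
  rw [integral_const_mul] at h
  rw [gaussMoment, gaussMoment, ← Nat.cast_succ, ← h]
  congr 1; ext t; ring

lemma gaussMoment_two : gaussMoment 2 = 1 := by
  simpa [gaussMoment_zero] using gaussMoment_add_two 0

lemma gaussMoment_three : gaussMoment 3 = 0 := by
  simpa [gaussMoment_one] using gaussMoment_add_two 1

lemma gaussMoment_four : gaussMoment 4 = 3 := by
  have := gaussMoment_add_two 2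
  norm_num [gaussMoment_two] at this
  exact this

lemma integral_prod_pow_stdPi (a : ι → ℕ) :
    ∫ x, ∏ e, x e ^ a e ∂(stdPi ι) = ∏ e, gaussMoment (a e) :=
  integral_fintype_prod_eq_prod (𝕜 := ℝ) (fun e (t : ℝ) => t ^ a e)

/-- The squarefree monomial of a set of coordinates. -/
def sqfree (P : Finset ι) (x : ι → ℝ) : ℝ := ∏ e ∈ P, x e

lemma sqfree_eq (P : Finset ι) (x : ι → ℝ) : sqfree P x = ∏ e, x e ^ (if e ∈ P then 1 else 0) := by
  simp [sqfree, Finset.prod_ite_mem, pow_ite]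

lemma integral_sqfree_two (P Q : Finset ι) :
    ∫ x, sqfree P x * sqfree Q x ∂(stdPi ι) = if P = Q then 1 else 0 := by
  simp only [sqfree_eq, ← Finset.prod_mul_distrib, ← pow_add]
  rw [integral_prod_pow_stdPi fun e => (if e ∈ P then 1 else 0) + (if e ∈ Q then 1 else 0)]
  split_ifs with h
  · subst h
    refine Finset.prod_eq_one fun e _ => ?_
    by_cases he : e ∈ P <;> simp [he, gaussMoment_zero, gaussMoment_two]
  · obtain ⟨e, he⟩ : ∃ e, ¬(e ∈ P ↔ e ∈ Q) := by
      by_contra hc; push Not at hc; exact h (Finset.ext hc)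
    refine Finset.prod_eq_zero (Finset.mem_univ e) ?_
    by_cases h1 : e ∈ P <;> by_cases h2 : e ∈ Q <;> simp_all [gaussMoment_one]

lemma integral_sqfree_four (P Q P' Q' : Finset ι) :
    ∫ x, (sqfree P x * sqfree Q x) * (sqfree P' x * sqfree Q' x) ∂(stdPi ι)
      = ∏ e, gaussMoment (((if e ∈ P then 1 else 0) + (if e ∈ Q then 1 else 0))
          + ((if e ∈ P' then 1 else 0) + (if e ∈ Q' then 1 else 0))) := by
  simp only [sqfree_eq, ← Finset.prod_mul_distrib, ← pow_add]
  exact integral_prod_pow_stdPi _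

/-- Covariances of products of two squarefree monomials: they vanish unless the symmetric
differences agree, and for trivial symmetric differences unless the sets meet. If the symmetric
differences agree, a coordinate in `P` has degree at most four and contributes at most the fourth
moment `3`, and a coordinate outside `P` has degree zero or two. -/
lemma abs_cov_sqfree_le (P Q P' Q' : Finset ι) :
    |∫ x, (sqfree P x * sqfree Q x) * (sqfree P' x * sqfree Q' x) ∂(stdPi ι)
        - (∫ x, sqfree P x * sqfree Q x ∂(stdPi ι)) * ∫ x, sqfree P' x * sqfree Q' x ∂(stdPi ι)|
      ≤ if symmDiff P Q = symmDiff P' Q' ∧ (P ≠ Q ∨ ¬Disjoint P P') then 3 ^ P.card else 0 := by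
  rw [integral_sqfree_four, integral_sqfree_two, integral_sqfree_two]
  by_cases hD : symmDiff P Q = symmDiff P' Q'
  · have hmem : ∀ e, ((e ∈ P ∧ e ∉ Q) ∨ (e ∈ Q ∧ e ∉ P)) ↔ ((e ∈ P' ∧ e ∉ Q') ∨ (e ∈ Q' ∧ e ∉ P')) :=
      fun e => by simpa [Finset.mem_symmDiff] using Finset.ext_iff.1 hD e
    have hb : ∀ e, 0 ≤ gaussMoment (((if e ∈ P then 1 else 0) + (if e ∈ Q then 1 else 0))
          + ((if e ∈ P' then 1 else 0) + (if e ∈ Q' then 1 else 0))) ∧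
        gaussMoment (((if e ∈ P then 1 else 0) + (if e ∈ Q then 1 else 0))
          + ((if e ∈ P' then 1 else 0) + (if e ∈ Q' then 1 else 0))) ≤ if e ∈ P then 3 else 1 := by
      intro e
      have := hmem e
      by_cases h1 : e ∈ P <;> by_cases h2 : e ∈ Q <;> by_cases h3 : e ∈ P' <;>
        by_cases h4 : e ∈ Q' <;>
        simp_all [gaussMoment_zero, gaussMoment_two, gaussMoment_four]
    by_cases hPQ : P = Q
    · subst hPQ
      have hPQ' : P' = Q' := by
        rw [symmDiff_self] at hD
        exact symmDiff_eq_bot.1 hD.symm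
      subst hPQ'
      by_cases hdis : Disjoint P P'
      · rw [Finset.prod_eq_one]
        · simp [hdis]
        · intro e _
          by_cases h1 : e ∈ P <;> by_cases h3 : e ∈ P'
          · exact absurd h3 (Finset.disjoint_left.1 hdis h1)
          all_goals simp [h1, h3, gaussMoment_zero, gaussMoment_two]
      · have hup : ∏ e, gaussMoment (((if e ∈ P then 1 else 0) + (if e ∈ P then 1 else 0))
          + ((if e ∈ P' then 1 else 0) + (if e ∈ P' then 1 else 0))) ≤ 3 ^ P.card := by
          refine (Finset.prod_le_prod (fun e _ => (hb e).1) fun e _ => (hb e).2).trans (le_of_eq ?_)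
          rw [Finset.prod_ite_mem]; simp
        have hlow : 1 ≤ ∏ e, gaussMoment (((if e ∈ P then 1 else 0) + (if e ∈ P then 1 else 0))
          + ((if e ∈ P' then 1 else 0) + (if e ∈ P' then 1 else 0))) := by
          refine Finset.one_le_prod fun e => ?_
          by_cases h1 : e ∈ P <;> by_cases h3 : e ∈ P' <;>
            simp [h1, h3, gaussMoment_zero, gaussMoment_two, gaussMoment_four]
        have hR : symmDiff P P = symmDiff P' P' ∧ (P ≠ P ∨ ¬Disjoint P P') := ⟨hD, Or.inr hdis⟩
        simp only [if_pos hR, if_true, abs_le]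
        constructor <;> linarith
    · have hR : symmDiff P Q = symmDiff P' Q' ∧ (P ≠ Q ∨ ¬Disjoint P P') := ⟨hD, Or.inl hPQ⟩
      rw [if_neg hPQ, zero_mul, sub_zero, if_pos hR,
        abs_of_nonneg (Finset.prod_nonneg fun e _ => (hb e).1)]
      refine (Finset.prod_le_prod (fun e _ => (hb e).1) fun e _ => (hb e).2).trans (le_of_eq ?_)
      rw [Finset.prod_ite_mem]; simp
  · obtain ⟨e, he⟩ : ∃ e, ¬(e ∈ symmDiff P Q ↔ e ∈ symmDiff P' Q') := by
      by_contra hc; push Not at hc; exact hD (Finset.ext hc)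
    rw [Finset.mem_symmDiff, Finset.mem_symmDiff] at he
    have h0 : gaussMoment (((if e ∈ P then 1 else 0) + (if e ∈ Q then 1 else 0))
          + ((if e ∈ P' then 1 else 0) + (if e ∈ Q' then 1 else 0))) = 0 := by
      by_cases h1 : e ∈ P <;> by_cases h2 : e ∈ Q <;> by_cases h3 : e ∈ P' <;>
        by_cases h4 : e ∈ Q' <;> simp_all [gaussMoment_one, gaussMoment_three]
    have h2 : ¬(P = Q ∧ P' = Q') := by
      rintro ⟨rfl, rfl⟩; simp at hD
    rw [Finset.prod_eq_zero (Finset.mem_univ e) h0]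
    have hR : ¬(symmDiff P Q = symmDiff P' Q' ∧ (P ≠ Q ∨ ¬Disjoint P P')) := fun h4 => hD h4.1
    rw [if_neg hR]
    by_cases h3 : P = Q
    · rw [if_neg fun h4 => h2 ⟨h3, h4⟩]; simp
    · rw [if_neg h3]; simp

end Moments

/-! ### Cycles, paths and the Stein matrix of the cycle counts -/

section Cycles

variable {n m : ℕ}

/-- A labelled cycle of length `2(k+1)` in the complete bipartite graph on `[n]` and `[m]`: the
column indices `i_0, …, i_k` and the row indices `j_0, …, j_k`, visited in the order
`i_0, j_0, i_1, j_1, …, i_k, j_k, i_0`. -/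
abbrev Cyc (n m k : ℕ) : Type := (Fin (k + 1) ↪ Fin n) × (Fin (k + 1) ↪ Fin m)

/-- The edges of a labelled cycle as pairs (row, column): `inl ℓ` is the edge from `i_ℓ` to `j_ℓ`
and `inr ℓ` the edge from `j_ℓ` to `i_{ℓ+1}`. -/
def cycEdge {k : ℕ} (A : Cyc n m k) : Fin (k + 1) ⊕ Fin (k + 1) → Fin m × Fin n :=
  Sum.elim (fun l => (A.2 l, A.1 l)) fun l => (A.2 l, A.1 (l + 1))

/-- The edge from `j_k` to `i_0` that closes the cycle. -/
def cycEnd {k : ℕ} (A : Cyc n m k) : Fin m × Fin n := (A.2 (Fin.last k), A.1 0)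

/-- The edges of the path `i_0, j_0, …, i_k, j_k`, that is of the cycle without `cycEnd`. -/
def pathEdge {k : ℕ} (A : Cyc n m k) : Fin (k + 1) ⊕ Fin k → Fin m × Fin n :=
  Sum.elim (fun l => (A.2 l, A.1 l)) fun l => (A.2 l.castSucc, A.1 l.succ)

lemma pathEdge_injective {k : ℕ} (A : Cyc n m k) : Function.Injective (pathEdge A) := by
  rintro (a | a) (b | b) h <;> simp only [pathEdge, Sum.elim_inl, Sum.elim_inr, Prod.mk.injEq,
    EmbeddingLike.apply_eq_iff_eq] at h
  · rw [h.1]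
  · exact absurd (h.1.symm.trans h.2) (Fin.castSucc_lt_succ).ne
  · exact absurd (h.1.trans h.2.symm) (Fin.castSucc_lt_succ).ne
  · rw [Fin.castSucc_inj.1 h.1]

/-- The edge set of the path of a labelled cycle. -/
def pathEdges {k : ℕ} (A : Cyc n m k) : Finset (Fin m × Fin n) :=
  Finset.univ.map ⟨pathEdge A, pathEdge_injective A⟩

lemma card_pathEdges {k : ℕ} (A : Cyc n m k) : (pathEdges A).card = 2 * k + 1 := by
  simp [pathEdges]; ring

lemma prod_pathEdges {k : ℕ} {R : Type*} [CommMonoid R] (A : Cyc n m k)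
    (f : Fin m × Fin n → R) :
    ∏ e ∈ pathEdges A, f e
      = (∏ l, f (A.2 l, A.1 l)) * ∏ l : Fin k, f (A.2 l.castSucc, A.1 l.succ) := by
  simp [pathEdges, pathEdge]

lemma mem_pathEdges {k : ℕ} (A : Cyc n m k) (e : Fin m × Fin n) :
    e ∈ pathEdges A ↔ (∃ l, (A.2 l, A.1 l) = e) ∨ ∃ l : Fin k, (A.2 l.castSucc, A.1 l.succ) = e := by
  simp [pathEdges, pathEdge]

/-- The cycle visits the edges of its path and the closing edge. -/
lemma prod_erase_cycEdge {k : ℕ} {R : Type*} [CommMonoid R] (A : Cyc n m k)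
    (f : Fin m × Fin n → R) :
    ∏ t ∈ Finset.univ.erase (Sum.inr (Fin.last k)), f (cycEdge A t) = ∏ e ∈ pathEdges A, f e := by
  have h : (Finset.univ.erase (Sum.inr (Fin.last k)) : Finset (Fin (k + 1) ⊕ Fin (k + 1)))
      = (Finset.univ : Finset (Fin (k + 1) ⊕ Fin k)).map
        ⟨Sum.map id Fin.castSucc, Function.injective_id.sumMap (Fin.castSucc_injective k)⟩ := by
    ext t
    rcases t with t | t
    · simp
    · induction t using Fin.lastCases with
      | last => simp [Fin.castSucc_ne_last]
      | cast t => simp [Fin.castSucc_ne_last]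
  rw [h, Finset.prod_map, pathEdges, Finset.prod_map]
  refine Finset.prod_congr rfl fun t _ => ?_
  rcases t with t | t <;> simp [cycEdge, pathEdge]

lemma prod_cycEdge {k : ℕ} {R : Type*} [CommMonoid R] (A : Cyc n m k) (f : Fin m × Fin n → R) :
    ∏ t, f (cycEdge A t) = f (cycEnd A) * ∏ e ∈ pathEdges A, f e := by
  rw [← prod_erase_cycEdge, ← Finset.mul_prod_erase _ _ (Finset.mem_univ (Sum.inr (Fin.last k)))]
  simp [cycEdge, cycEnd]

/-- Rotation of a labelled cycle. -/
def rotCyc {k : ℕ} (r : Fin (k + 1)) : Cyc n m k ≃ Cyc n m k where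
  toFun A := ((Equiv.addRight r).toEmbedding.trans A.1, (Equiv.addRight r).toEmbedding.trans A.2)
  invFun A := ((Equiv.addRight (-r)).toEmbedding.trans A.1,
    (Equiv.addRight (-r)).toEmbedding.trans A.2)
  left_inv A := by ext <;> simp
  right_inv A := by ext <;> simp

lemma cycEdge_rotCyc {k : ℕ} (r : Fin (k + 1)) (A : Cyc n m k) (t) :
    cycEdge (rotCyc r A) t = cycEdge A (Sum.map (Equiv.addRight r) (Equiv.addRight r) t) := by
  rcases t with t | t <;> simp [cycEdge, rotCyc, add_right_comm]

/-- Reflection of a labelled cycle. -/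
def reflCyc {k : ℕ} : Cyc n m k ≃ Cyc n m k where
  toFun A := ((Equiv.subLeft 1).toEmbedding.trans A.1, (Equiv.neg _).toEmbedding.trans A.2)
  invFun A := ((Equiv.subLeft 1).toEmbedding.trans A.1, (Equiv.neg _).toEmbedding.trans A.2)
  left_inv A := by ext <;> simp
  right_inv A := by ext <;> simp

lemma cycEdge_reflCyc {k : ℕ} (A : Cyc n m k) (t) :
    cycEdge (reflCyc A) t = cycEdge A ((Equiv.sumCongr (Equiv.neg _) (Equiv.neg _)).trans
      (Equiv.sumComm _ _) t) := by
  rcases t with t | t <;> simp [cycEdge, reflCyc, sub_eq_add_neg, add_comm]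

/-- The dihedral symmetries of labelled cycles move any edge position to the last one. -/
lemma exists_cyc_symmetry {k : ℕ} (t : Fin (k + 1) ⊕ Fin (k + 1)) :
    ∃ (ρ : Cyc n m k ≃ Cyc n m k) (π : Equiv.Perm (Fin (k + 1) ⊕ Fin (k + 1))),
      (∀ A s, cycEdge (ρ A) s = cycEdge A (π s)) ∧ π (Sum.inr (Fin.last k)) = t := by
  rcases t with t | t
  · refine ⟨(rotCyc (t + Fin.last k)).trans reflCyc,
      ((Equiv.sumCongr (Equiv.neg _) (Equiv.neg _)).trans (Equiv.sumComm _ _)).trans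
        (Equiv.sumCongr (Equiv.addRight (t + Fin.last k)) (Equiv.addRight (t + Fin.last k))),
      fun A s => ?_, ?_⟩
    · rw [Equiv.trans_apply, cycEdge_reflCyc, cycEdge_rotCyc]; rfl
    · simp
      have h : 1 + (t + Fin.last k) = t + (Fin.last k + 1) := by abel
      exact h.trans (by rw [Fin.last_add_one]; simp)
  · refine ⟨rotCyc (t - Fin.last k),
      Equiv.sumCongr (Equiv.addRight (t - Fin.last k)) (Equiv.addRight (t - Fin.last k)),
      fun A s => ?_, ?_⟩
    · rw [cycEdge_rotCyc]; rfl
    · simp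

open MvPolynomial

lemma pderiv_prod_X {ι κ : Type*} [DecidableEq ι] [DecidableEq κ] (s : Finset κ) (c : κ → ι)
    (e : ι) : pderiv e (∏ t ∈ s, X (c t) : MvPolynomial ι ℝ)
      = ∑ t ∈ s, if c t = e then ∏ t' ∈ s.erase t, X (c t') else 0 := by
  induction s using Finset.induction_on with
  | empty => simp
  | insert a s ha ih =>
    have hX : pderiv e (X (c a) : MvPolynomial ι ℝ) = if c a = e then 1 else 0 := by
      by_cases h : c a = e
      · subst h; simp
      · simp [h, pderiv_X_of_ne h]
    rw [Finset.prod_insert ha, pderiv_mul, ih, hX, Finset.sum_insert ha, Finset.erase_insert ha,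
      Finset.mul_sum, ite_mul, one_mul, zero_mul]
    congr 1
    refine Finset.sum_congr rfl fun t ht => ?_
    have hta : a ≠ t := fun h => ha (h ▸ ht)
    rw [Finset.erase_insert_of_ne hta, Finset.prod_insert fun h => ha (Finset.mem_of_mem_erase h),
      mul_ite, mul_zero]

/-- The sum over the self-avoiding paths with `2k+1` edges that join the end points of the edge
`e`, of the products of the variables along the path. -/
noncomputable def pathPoly (n m k : ℕ) (e : Fin m × Fin n) : MvPolynomial (Fin m × Fin n) ℝ :=
  ∑ A : Cyc n m k, if cycEnd A = e then ∏ e' ∈ pathEdges A, X e' else 0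

/-- The unnormalized cycle count as a polynomial. -/
noncomputable def cyclePoly (n m k : ℕ) : MvPolynomial (Fin m × Fin n) ℝ :=
  (∑ A : Cyc n m k, ∏ t, X (cycEdge A t)) - if k = 0 then C ((m : ℝ) * n) else 0

lemma pderiv_cyclePoly (k : ℕ) (e : Fin m × Fin n) :
    pderiv e (cyclePoly n m k) = C (2 * ((k : ℝ) + 1)) * pathPoly n m k e := by
  have hc : pderiv e (if k = 0 then C ((m : ℝ) * n) else 0 : MvPolynomial (Fin m × Fin n) ℝ) = 0 := by
    split_ifs <;> simp
  have key (t : Fin (k + 1) ⊕ Fin (k + 1)) :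
      (∑ A : Cyc n m k, if cycEdge A t = e then ∏ t' ∈ Finset.univ.erase t, X (cycEdge A t') else 0)
        = pathPoly n m k e := by
    obtain ⟨ρ, π, h1, h2⟩ := exists_cyc_symmetry (n := n) (m := m) t
    rw [pathPoly]
    refine Eq.trans ?_ (Equiv.sum_comp ρ _)
    refine Finset.sum_congr rfl fun A _ => ?_
    have h3 : cycEnd (ρ A) = cycEdge A t := by
      rw [← h2, ← h1]; simp [cycEnd, cycEdge]
    rw [h3, ← prod_erase_cycEdge]
    congr 1
    simp only [h1]
    rw [← h2]
    refine (Finset.prod_equiv π (fun s => ?_) fun s _ => rfl).symm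
    simp
  rw [cyclePoly, map_sub, hc, sub_zero, map_sum]
  simp only [pderiv_prod_X]
  rw [Finset.sum_comm, Finset.sum_congr rfl fun t _ => key t, Finset.sum_const, Finset.card_univ]
  simp only [Fintype.card_sum, Fintype.card_fin, nsmul_eq_mul]
  congr 1
  simp only [map_mul, map_add, map_natCast, map_one, map_ofNat]
  push_cast
  ring

/-- The closing edge belongs to the path only for the cycles of length two. -/
lemma cycEnd_mem_pathEdges_iff {k : ℕ} (A : Cyc n m k) : cycEnd A ∈ pathEdges A ↔ k = 0 := by
  rw [mem_pathEdges]
  constructor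
  · rintro (⟨l, hl⟩ | ⟨l, hl⟩) <;> simp only [cycEnd, Prod.mk.injEq,
      EmbeddingLike.apply_eq_iff_eq] at hl
    · have := hl.1.symm.trans hl.2
      simpa using this
    · exact absurd hl.1 (Fin.castSucc_ne_last l)
  · rintro rfl
    exact Or.inl ⟨0, rfl⟩

lemma gaussDiv_pathPoly (k : ℕ) : gaussDiv (pathPoly n m k) = cyclePoly n m k := by
  rw [gaussDiv, Finset.sum_sub_distrib, cyclePoly]
  congr 1
  · simp only [pathPoly, Finset.mul_sum, mul_ite, mul_zero]
    rw [Finset.sum_comm]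
    refine Finset.sum_congr rfl fun A _ => ?_
    rw [Finset.sum_ite_eq Finset.univ (cycEnd A), if_pos (Finset.mem_univ _)]
    exact (prod_cycEdge A X).symm
  · have h1 (e : Fin m × Fin n) : pderiv e (pathPoly n m k e)
        = ∑ A : Cyc n m k, if cycEnd A = e then (if k = 0 then 1 else 0) else 0 := by
      rw [pathPoly, map_sum]
      refine Finset.sum_congr rfl fun A _ => ?_
      by_cases h : cycEnd A = e
      · subst h
        simp only [if_true]
        rw [pderiv_prod_X _ (fun e => e)]
        by_cases hk : k = 0
        · subst hk
          have hs : pathEdges A = {cycEnd A} := by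
            refine (Finset.eq_of_subset_of_card_le ?_ ?_).symm
            · simpa using (cycEnd_mem_pathEdges_iff A).2 rfl
            · simp [card_pathEdges]
          simp [hs]
        · rw [if_neg hk]
          refine Finset.sum_eq_zero fun t ht => if_neg ?_
          rintro rfl
          exact hk ((cycEnd_mem_pathEdges_iff A).1 ht)
      · simp [h]
    simp only [h1]
    rw [Finset.sum_comm]
    by_cases hk : k = 0
    · subst hk
      simp [Fintype.card_embedding_eq]
      ring
    · simp [hk]

/-- The polynomial of the normalized cycle count, the `k`-th coordinate of `cycleVector`. -/
noncomputable def cycleCoord (n m k : ℕ) : MvPolynomial (Fin m × Fin n) ℝ :=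
  C ((1 / √(n : ℝ)) ^ (k + 1) * (1 / √(m : ℝ)) ^ (k + 1) / √(2 * ((k : ℝ) + 1))) * cyclePoly n m k

/-- The normalized vector field of path polynomials, whose divergence is `cycleCoord`. -/
noncomputable def pathCoord (n m k : ℕ) (e : Fin m × Fin n) : MvPolynomial (Fin m × Fin n) ℝ :=
  C ((1 / √(n : ℝ)) ^ (k + 1) * (1 / √(m : ℝ)) ^ (k + 1) / √(2 * ((k : ℝ) + 1))) * pathPoly n m k e

lemma gaussDiv_pathCoord (k : ℕ) : gaussDiv (pathCoord n m k) = cycleCoord n m k := by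
  rw [cycleCoord, ← gaussDiv_pathPoly, gaussDiv, gaussDiv, Finset.mul_sum]
  refine Finset.sum_congr rfl fun e _ => ?_
  rw [pathCoord, pderiv_C_mul]
  ring

lemma eval_cycleCoord (k : ℕ) (M : ℕ → EuclideanSpace ℝ (Fin n)) :
    eval (fun e : Fin m × Fin n => M e.1 e.2) (cycleCoord n m k)
      = cycleCount (k + 1) m M / √(2 * ((k : ℝ) + 1)) := by
  have h1 : eval (fun e : Fin m × Fin n => M e.1 e.2)
        (∑ A : Cyc n m k, ∏ t, X (cycEdge A t))
      = ∑ i : Fin (k + 1) ↪ Fin n, ∑ j : Fin (k + 1) ↪ Fin m,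
        ∏ l : Fin (k + 1), M (j l) (i l) * M (j l) (i (finRotate (k + 1) l)) := by
    rw [map_sum, Fintype.sum_prod_type]
    refine Finset.sum_congr rfl fun i _ => Finset.sum_congr rfl fun j _ => ?_
    simp [cycEdge, Finset.prod_mul_distrib]
  rw [cycleCoord, cyclePoly, cycleCount, map_mul, map_sub, h1, eval_C]
  by_cases hk : k = 0
  · subst hk
    simp only [if_true, eval_C, zero_add]
    have : (1 / √(n : ℝ)) ^ 1 * (1 / √(m : ℝ)) ^ 1 * ((m : ℝ) * n) = √((m : ℝ) * n) := by
      rw [Real.sqrt_mul (Nat.cast_nonneg m)]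
      have hm : (1 / √(m : ℝ)) * m = √(m : ℝ) := by rw [one_div_mul_eq_div, Real.div_sqrt]
      have hn : (1 / √(n : ℝ)) * n = √(n : ℝ) := by rw [one_div_mul_eq_div, Real.div_sqrt]
      calc _ = ((1 / √(m : ℝ)) * m) * ((1 / √(n : ℝ)) * n) := by ring
        _ = _ := by rw [hm, hn]
    rw [← this]
    ring
  · simp only [hk, if_false, map_zero, sub_zero, Nat.add_eq_right]
    ring

/-- The sum over pairs of self-avoiding paths, with `2k+1` and `2l+1` edges, that have the same
end points, of the products of the variables along both paths. -/
noncomputable def pathPairSum (n m k l : ℕ) (x : Fin m × Fin n → ℝ) : ℝ :=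
  ∑ A : Cyc n m k, ∑ B : Cyc n m l,
    if cycEnd A = cycEnd B then sqfree (pathEdges A) x * sqfree (pathEdges B) x else 0

lemma eval_steinMatrix_cycles {K : ℕ} (k l : Fin K) (x : Fin m × Fin n → ℝ) :
    eval x (steinMatrix (fun k : Fin K => pathCoord n m k) (fun k : Fin K => cycleCoord n m k) k l)
      = (1 / √(n : ℝ)) ^ ((k : ℕ) + 1 + (l + 1)) * (1 / √(m : ℝ)) ^ ((k : ℕ) + 1 + (l + 1))
        * (√(2 * ((l : ℝ) + 1)) / √(2 * ((k : ℝ) + 1))) * pathPairSum n m k l x := by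
  have h1 : ∀ (k : ℕ) (e : Fin m × Fin n), eval x (pathPoly n m k e)
      = ∑ A : Cyc n m k, if cycEnd A = e then sqfree (pathEdges A) x else 0 := fun k e => by
    rw [pathPoly, map_sum]
    refine Finset.sum_congr rfl fun A _ => ?_
    split_ifs <;> simp [sqfree]
  have h2 : pathPairSum n m k l x
      = ∑ e, eval x (pathPoly n m k e) * eval x (pathPoly n m l e) := by
    simp only [h1, Finset.sum_mul_sum, pathPairSum]
    rw [Finset.sum_comm]
    simp only [Finset.sum_comm (s := (Finset.univ : Finset (Fin m × Fin n)))]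
    rw [Finset.sum_comm]
    refine Finset.sum_congr rfl fun A _ => Finset.sum_congr rfl fun B _ => ?_
    simp only [ite_mul, zero_mul]
    rw [Finset.sum_ite_eq Finset.univ (cycEnd A), if_pos (Finset.mem_univ _)]
    simp [eq_comm]
  have h3 : 2 * ((l : ℝ) + 1) / √(2 * ((l : ℝ) + 1)) = √(2 * ((l : ℝ) + 1)) := Real.div_sqrt
  rw [h2, steinMatrix, map_sum, Finset.mul_sum]
  refine Finset.sum_congr rfl fun e _ => ?_
  simp only [pathCoord, cycleCoord, pderiv_C_mul, pderiv_cyclePoly, map_mul, eval_C]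
  generalize √(2 * ((l : ℝ) + 1)) = a at h3 ⊢
  generalize √(2 * ((k : ℝ) + 1)) = b
  linear_combination ((1 / √(n : ℝ)) ^ ((k : ℕ) + 1 + (l + 1))
    * (1 / √(m : ℝ)) ^ ((k : ℕ) + 1 + (l + 1)) / b * eval x (pathPoly n m k e)
    * eval x (pathPoly n m l e)) * h3

end Cycles

/-! ### Paths are determined by their edges -/

section Paths

variable {n m : ℕ}

/-- A path contained in another path with the same end points follows it step by step. -/
lemma path_agree {k l : ℕ} (A : Cyc n m k) (B : Cyc n m l) (he : cycEnd A = cycEnd B)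
    (hs : pathEdges A ⊆ pathEdges B) (t : ℕ) (h : t < k + 1) :
    ∃ h' : t < l + 1, A.1 ⟨t, h⟩ = B.1 ⟨t, h'⟩ ∧ A.2 ⟨t, h⟩ = B.2 ⟨t, h'⟩ := by
  induction t with
  | zero =>
    have h0 : A.1 0 = B.1 0 := congrArg Prod.snd he
    refine ⟨Nat.succ_pos l, h0, ?_⟩
    have hm := hs ((mem_pathEdges A (A.2 0, A.1 0)).2 (Or.inl ⟨0, rfl⟩))
    rcases (mem_pathEdges B _).1 hm with ⟨s, hs⟩ | ⟨s, hs⟩ <;> rw [Prod.mk.injEq] at hs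
    · rw [h0, EmbeddingLike.apply_eq_iff_eq] at hs
      rw [hs.2] at hs
      exact hs.1.symm
    · rw [h0, EmbeddingLike.apply_eq_iff_eq] at hs
      exact absurd hs.2 (Fin.succ_ne_zero s)
  | succ t ih =>
    obtain ⟨h1, hi, hj⟩ := ih (by omega)
    -- the column step: the edge from `j_t` to `i_{t+1}`
    have hm := hs ((mem_pathEdges A (A.2 ⟨t, by omega⟩, A.1 ⟨t + 1, h⟩)).2
      (Or.inr ⟨⟨t, by omega⟩, rfl⟩))
    have hcol : ∃ h' : t + 1 < l + 1, A.1 ⟨t + 1, h⟩ = B.1 ⟨t + 1, h'⟩ := by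
      rcases (mem_pathEdges B _).1 hm with ⟨s, hs⟩ | ⟨s, hs⟩ <;> rw [Prod.mk.injEq] at hs
      · rw [hj, EmbeddingLike.apply_eq_iff_eq] at hs
        have h5 := hs.2
        rw [hs.1, ← hi, EmbeddingLike.apply_eq_iff_eq] at h5
        exact absurd (congrArg Fin.val h5) (by simp)
      · rw [hj, EmbeddingLike.apply_eq_iff_eq] at hs
        have hst : (s : ℕ) = t := congrArg Fin.val hs.1
        have hlt := s.isLt
        refine ⟨by omega, ?_⟩
        rw [← hs.2]
        congr 1
        ext
        simp [hst]
    obtain ⟨h2, hc⟩ := hcol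
    refine ⟨h2, hc, ?_⟩
    -- the row step: the edge from `i_{t+1}` to `j_{t+1}`
    have hm := hs ((mem_pathEdges A (A.2 ⟨t + 1, h⟩, A.1 ⟨t + 1, h⟩)).2 (Or.inl ⟨_, rfl⟩))
    rcases (mem_pathEdges B _).1 hm with ⟨s, hs⟩ | ⟨s, hs⟩ <;> rw [Prod.mk.injEq] at hs
    · rw [hc, EmbeddingLike.apply_eq_iff_eq] at hs
      rw [hs.2] at hs
      exact hs.1.symm
    · rw [hc, EmbeddingLike.apply_eq_iff_eq] at hs
      have hst : (s : ℕ) + 1 = t + 1 := congrArg Fin.val hs.2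
      have hst' : s.castSucc = ⟨t, h1⟩ := by ext; simp; omega
      have h5 := hs.1
      rw [hst', ← hj, EmbeddingLike.apply_eq_iff_eq] at h5
      exact absurd (congrArg Fin.val h5) (by simp)

lemma length_eq_of_pathEdges_subset {k l : ℕ} (A : Cyc n m k) (B : Cyc n m l)
    (he : cycEnd A = cycEnd B) (hs : pathEdges A ⊆ pathEdges B) : k = l := by
  obtain ⟨h', -, hj⟩ := path_agree A B he hs k (Nat.lt_succ_self k)
  have h2 : A.2 (Fin.last k) = B.2 (Fin.last l) := congrArg Prod.fst he
  have h3 : B.2 ⟨k, h'⟩ = B.2 (Fin.last l) := hj.symm.trans h2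
  rw [EmbeddingLike.apply_eq_iff_eq] at h3
  exact congrArg Fin.val h3

lemma eq_of_pathEdges_subset {k : ℕ} (A B : Cyc n m k) (he : cycEnd A = cycEnd B)
    (hs : pathEdges A ⊆ pathEdges B) : A = B := by
  have h := path_agree A B he hs
  refine Prod.ext ?_ ?_
  · ext t; exact congrArg Fin.val (h t t.isLt).2.1
  · ext t; exact congrArg Fin.val (h t t.isLt).2.2

lemma card_pathEdges_row {k : ℕ} (B : Cyc n m k) (i : Fin n) :
    (Finset.univ.filter fun j => (j, i) ∈ pathEdges B).card ≤ 2 := by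
  by_cases hi : ∃ s, B.1 s = i
  · obtain ⟨s, rfl⟩ := hi
    refine (Finset.card_le_card (t := {B.2 s, B.2 (s - 1)}) fun j hj => ?_).trans
      Finset.card_le_two
    rw [Finset.mem_filter, mem_pathEdges] at hj
    rcases hj.2 with ⟨t, ht⟩ | ⟨t, ht⟩ <;> rw [Prod.mk.injEq, EmbeddingLike.apply_eq_iff_eq] at ht
    · simp [← ht.1, ht.2]
    · have : t.castSucc = s - 1 := by
        rw [← ht.2, eq_sub_iff_add_eq]; exact Fin.coeSucc_eq_succ
      simp [← ht.1, this]
  · rw [Finset.filter_eq_empty_iff.2]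
    · simp
    · intro j _ hj
      rcases (mem_pathEdges B _).1 hj with ⟨t, ht⟩ | ⟨t, ht⟩ <;> rw [Prod.mk.injEq] at ht <;>
        exact hi ⟨_, ht.2⟩

lemma card_pathEdges_col {k : ℕ} (B : Cyc n m k) (j : Fin m) :
    (Finset.univ.filter fun i => (j, i) ∈ pathEdges B).card ≤ 2 := by
  by_cases hj : ∃ s, B.2 s = j
  · obtain ⟨s, rfl⟩ := hj
    refine (Finset.card_le_card (t := {B.1 s, B.1 (s + 1)}) fun i hi => ?_).trans
      Finset.card_le_two
    rw [Finset.mem_filter, mem_pathEdges] at hi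
    rcases hi.2 with ⟨t, ht⟩ | ⟨t, ht⟩ <;> rw [Prod.mk.injEq, EmbeddingLike.apply_eq_iff_eq] at ht
    · simp [← ht.1, ht.2]
    · have : t.succ = s + 1 := by rw [← ht.1, Fin.coeSucc_eq_succ]
      simp [← ht.2, this]
  · rw [Finset.filter_eq_empty_iff.2]
    · simp
    · intro i _ hi
      rcases (mem_pathEdges B _).1 hi with ⟨t, ht⟩ | ⟨t, ht⟩ <;> rw [Prod.mk.injEq] at ht <;>
        exact hj ⟨_, ht.1⟩

end Paths

/-! ### Weighted walks -/

section Walks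

variable {n m : ℕ}

/-- The weighted number of walks with `2k+1` steps from the column `a` to the row `b`; the entries
of `(M Mᵀ)^k M`. -/
def walkSum (M : Fin n → Fin m → ℝ) : ℕ → Fin n → Fin m → ℝ
  | 0, a, b => M a b
  | k + 1, a, b => ∑ c, ∑ a', M a c * M a' c * walkSum M k a' b

/-- The weight of the walk `i_0, j_0, i_1, …, i_k, j_k`. -/
def walkWeight (M : Fin n → Fin m → ℝ) {k : ℕ} (i : Fin (k + 1) → Fin n) (j : Fin (k + 1) → Fin m) :
    ℝ := (∏ t, M (i t) (j t)) * ∏ t : Fin k, M (i t.succ) (j t.castSucc)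

lemma walkWeight_cons (M : Fin n → Fin m → ℝ) {k : ℕ} (a : Fin n) (c : Fin m)
    (i : Fin (k + 1) → Fin n) (j : Fin (k + 1) → Fin m) :
    walkWeight M (Fin.cons a i : Fin (k + 2) → Fin n) (Fin.cons c j : Fin (k + 2) → Fin m)
      = M a c * M (i 0) c * walkWeight M i j := by
  have h1 : ∏ t, M ((Fin.cons a i : Fin (k + 2) → Fin n) t) ((Fin.cons c j : Fin (k + 2) → Fin m) t)
      = M a c * ∏ t, M (i t) (j t) := by
    rw [Fin.prod_univ_succ]; simp only [Fin.cons_zero, Fin.cons_succ]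
  have h2 : ∏ t : Fin (k + 1), M ((Fin.cons a i : Fin (k + 2) → Fin n) t.succ)
        ((Fin.cons c j : Fin (k + 2) → Fin m) t.castSucc)
      = M (i 0) c * ∏ t : Fin k, M (i t.succ) (j t.castSucc) := by
    rw [Fin.prod_univ_succ]
    simp only [Fin.castSucc_zero, Fin.cons_zero, Fin.cons_succ, ← Fin.succ_castSucc]
  rw [walkWeight, walkWeight, h1, h2]
  ring

lemma sum_fun_succ {α : Type*} [Fintype α] {k : ℕ} (f : (Fin (k + 1) → α) → ℝ) :
    ∑ v, f v = ∑ a, ∑ v : Fin k → α, f (Fin.cons a v) := by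
  rw [← Fintype.sum_prod_type']
  exact (Equiv.sum_comp (Fin.consEquiv fun _ : Fin (k + 1) => α) f).symm

lemma sum_walkWeight (M : Fin n → Fin m → ℝ) (k : ℕ) (a : Fin n) (b : Fin m) :
    ∑ i : Fin (k + 1) → Fin n, ∑ j : Fin (k + 1) → Fin m,
      (if i 0 = a ∧ j (Fin.last k) = b then walkWeight M i j else 0) = walkSum M k a b := by
  induction k generalizing a with
  | zero =>
    rw [sum_fun_succ]
    simp only [sum_fun_succ (α := Fin m)]
    simp [walkWeight, walkSum, ite_and, Fin.last]
  | succ k ih =>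
    rw [sum_fun_succ, Finset.sum_eq_single a]
    · have hj (i : Fin (k + 1) → Fin n) := sum_fun_succ (α := Fin m) fun j =>
        if (Fin.cons a i : Fin (k + 2) → Fin n) 0 = a ∧ j (Fin.last (k + 1)) = b then
          walkWeight M (Fin.cons a i : Fin (k + 2) → Fin n) j else 0
      simp only [hj, walkWeight_cons, walkSum]
      rw [Finset.sum_comm]
      refine Finset.sum_congr rfl fun c _ => ?_
      simp only [← ih, Finset.mul_sum]
      refine Eq.trans ?_ Finset.sum_comm
      refine Finset.sum_congr rfl fun i _ => ?_
      refine Eq.trans ?_ Finset.sum_comm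
      refine Finset.sum_congr rfl fun j _ => ?_
      have hl : (Fin.cons c j : Fin (k + 2) → Fin m) (Fin.last (k + 1)) = j (Fin.last k) := by
        rw [← Fin.succ_last, Fin.cons_succ]
      simp only [Fin.cons_zero, hl, true_and, ite_and, mul_ite, mul_zero]
      rw [Finset.sum_ite_eq, if_pos (Finset.mem_univ _)]
    · intro a' _ ha'
      simp [ha']
    · simp

variable {M Y : Fin n → Fin m → ℝ} {R : ℝ}

lemma walkSum_nonneg (hM : ∀ a c, 0 ≤ M a c) (k : ℕ) (a : Fin n) (b : Fin m) :
    0 ≤ walkSum M k a b := by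
  induction k generalizing a with
  | zero => exact hM a b
  | succ k ih =>
    exact Finset.sum_nonneg fun c _ => Finset.sum_nonneg fun a' _ =>
      mul_nonneg (mul_nonneg (hM _ _) (hM _ _)) (ih a')

lemma sum_walkSum_le (hM : ∀ a c, 0 ≤ M a c) (hR : 0 ≤ R) (hrow : ∀ a, ∑ c, M a c ≤ R)
    (hcol : ∀ c, ∑ a, M a c ≤ R) (k : ℕ) (b : Fin m) :
    ∑ a, walkSum M k a b ≤ R ^ (2 * k + 1) := by
  induction k with
  | zero => simpa [walkSum] using hcol b
  | succ k ih =>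
    calc ∑ a, walkSum M (k + 1) a b
        = ∑ c, ∑ a', (∑ a, M a c) * (M a' c * walkSum M k a' b) := by
          simp only [walkSum, Finset.sum_mul]
          rw [Finset.sum_comm]
          refine Finset.sum_congr rfl fun c _ => ?_
          rw [Finset.sum_comm]
          refine Finset.sum_congr rfl fun a' _ => Finset.sum_congr rfl fun a _ => by ring
      _ ≤ ∑ c, ∑ a', R * (M a' c * walkSum M k a' b) := by
          refine Finset.sum_le_sum fun c _ => Finset.sum_le_sum fun a' _ => ?_
          exact mul_le_mul_of_nonneg_right (hcol c)
            (mul_nonneg (hM _ _) (walkSum_nonneg hM k a' b))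
      _ = R * ∑ a', (∑ c, M a' c) * walkSum M k a' b := by
          simp only [Finset.mul_sum, Finset.sum_mul]
          rw [Finset.sum_comm]
      _ ≤ R * ∑ a', R * walkSum M k a' b := by
          refine mul_le_mul_of_nonneg_left (Finset.sum_le_sum fun a' _ => ?_) hR
          exact mul_le_mul_of_nonneg_right (hrow a') (walkSum_nonneg hM k a' b)
      _ = R * R * ∑ a', walkSum M k a' b := by rw [← Finset.mul_sum, mul_assoc]
      _ ≤ R * R * R ^ (2 * k + 1) := mul_le_mul_of_nonneg_left ih (mul_nonneg hR hR)
      _ = R ^ (2 * (k + 1) + 1) := by ring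

/-- Walks between fixed end points of which at least one step has the weight `1` instead of the
additional weight `Y` are fewer by a factor `R`. -/
lemma walkSum_sub_le (hY : ∀ a c, 0 ≤ Y a c) (hMY : ∀ a c, M a c = 1 + Y a c) (hR : 0 ≤ R)
    (hrow : ∀ a, ∑ c, M a c ≤ R) (hcol : ∀ c, ∑ a, M a c ≤ R) (k : ℕ) (a : Fin n) (b : Fin m) :
    walkSum M k a b - walkSum Y k a b ≤ (2 * k + 1) * R ^ (2 * k) := by
  have hM : ∀ a c, 0 ≤ M a c := fun a c => by rw [hMY]; linarith [hY a c]
  have hYrow : ∀ a, ∑ c, Y a c ≤ R := fun a =>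
    (Finset.sum_le_sum fun c _ => by rw [hMY]; linarith).trans (hrow a)
  have hYcol : ∀ c, ∑ a, Y a c ≤ R := fun c =>
    (Finset.sum_le_sum fun a _ => by rw [hMY]; linarith).trans (hcol c)
  induction k generalizing a with
  | zero => simp [walkSum, hMY]
  | succ k ih =>
    have hT := sum_walkSum_le hM hR hrow hcol k b
    have hT0 := walkSum_nonneg hM k (b := b)
    have e : walkSum M (k + 1) a b - walkSum Y (k + 1) a b
        = (∑ a', (∑ c, M a' c) * walkSum M k a' b) + (∑ c, Y a c) * (∑ a', walkSum M k a' b)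
          + ∑ c, ∑ a', Y a c * Y a' c * (walkSum M k a' b - walkSum Y k a' b) := by
      simp only [walkSum, Finset.sum_mul_sum]
      simp only [Finset.sum_mul]
      rw [Finset.sum_comm (γ := Fin n) (f := fun a' c => M a' c * walkSum M k a' b)]
      simp only [← Finset.sum_sub_distrib, ← Finset.sum_add_distrib]
      refine Finset.sum_congr rfl fun c _ => Finset.sum_congr rfl fun a' _ => ?_
      rw [hMY a c, hMY a' c]; ring
    have b1 : ∑ a', (∑ c, M a' c) * walkSum M k a' b ≤ R * R ^ (2 * k + 1) := by
      refine le_trans (Finset.sum_le_sum fun a' _ =>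
        mul_le_mul_of_nonneg_right (hrow a') (hT0 a')) ?_
      rw [← Finset.mul_sum]
      exact mul_le_mul_of_nonneg_left hT hR
    have b2 : (∑ c, Y a c) * (∑ a', walkSum M k a' b) ≤ R * R ^ (2 * k + 1) :=
      mul_le_mul (hYrow a) hT (Finset.sum_nonneg fun a' _ => hT0 a') hR
    have b3 : ∑ c, ∑ a', Y a c * Y a' c * (walkSum M k a' b - walkSum Y k a' b)
        ≤ R * R * ((2 * k + 1) * R ^ (2 * k)) := by
      have hpos : 0 ≤ (2 * (k : ℝ) + 1) * R ^ (2 * k) := by positivity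
      calc _ ≤ ∑ c, ∑ a', Y a c * Y a' c * ((2 * k + 1) * R ^ (2 * k)) :=
            Finset.sum_le_sum fun c _ => Finset.sum_le_sum fun a' _ =>
              mul_le_mul_of_nonneg_left (ih a') (mul_nonneg (hY _ _) (hY _ _))
        _ = (∑ c, Y a c * ∑ a', Y a' c) * ((2 * k + 1) * R ^ (2 * k)) := by
            simp only [Finset.mul_sum, Finset.sum_mul]
        _ ≤ (∑ c, Y a c * R) * ((2 * k + 1) * R ^ (2 * k)) := by
            refine mul_le_mul_of_nonneg_right (Finset.sum_le_sum fun c _ => ?_) hpos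
            exact mul_le_mul_of_nonneg_left (hYcol c) (hY _ _)
        _ ≤ R * R * ((2 * k + 1) * R ^ (2 * k)) := by
            rw [← Finset.sum_mul]
            exact mul_le_mul_of_nonneg_right (mul_le_mul_of_nonneg_right (hYrow a) hR) hpos
    rw [e]
    push_cast
    calc _ ≤ R * R ^ (2 * k + 1) + R * R ^ (2 * k + 1) + R * R * ((2 * k + 1) * R ^ (2 * k)) :=
          add_le_add (add_le_add b1 b2) b3
      _ = _ := by ring

end Walks

/-! ### Paths weighted by shared edges -/

section Counting

variable {n m : ℕ}

/-- The weight of a step: `1`, plus `N` along the edges of `D`. -/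
def stepWeight (N : ℝ) (D : Finset (Fin m × Fin n)) (a : Fin n) (c : Fin m) : ℝ :=
  1 + if (c, a) ∈ D then N else 0

lemma sum_stepWeight_row_le {N : ℝ} (hm : (m : ℝ) ≤ N) (hN : 0 ≤ N) {D : Finset (Fin m × Fin n)}
    {d : ℕ} {a : Fin n} (hD : (Finset.univ.filter fun c => (c, a) ∈ D).card ≤ d) :
    ∑ c, stepWeight N D a c ≤ (d + 1) * N := by
  have hd : ((Finset.univ.filter fun c => (c, a) ∈ D).card : ℝ) ≤ d := by exact_mod_cast hD
  simp only [stepWeight, Finset.sum_add_distrib, Finset.sum_const, Finset.card_univ,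
    Fintype.card_fin, nsmul_eq_mul, mul_one, ← Finset.sum_filter]
  linarith [mul_le_mul_of_nonneg_right hd hN]

lemma sum_stepWeight_col_le {N : ℝ} (hn : (n : ℝ) ≤ N) (hN : 0 ≤ N) {D : Finset (Fin m × Fin n)}
    {d : ℕ} {c : Fin m} (hD : (Finset.univ.filter fun a => (c, a) ∈ D).card ≤ d) :
    ∑ a, stepWeight N D a c ≤ (d + 1) * N := by
  have hd : ((Finset.univ.filter fun a => (c, a) ∈ D).card : ℝ) ≤ d := by exact_mod_cast hD
  simp only [stepWeight, Finset.sum_add_distrib, Finset.sum_const, Finset.card_univ,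
    Fintype.card_fin, nsmul_eq_mul, mul_one, ← Finset.sum_filter]
  linarith [mul_le_mul_of_nonneg_right hd hN]

lemma walkWeight_eq_prod_pathEdges {k : ℕ} (f : Fin n → Fin m → ℝ) (A : Cyc n m k) :
    walkWeight f A.1 A.2 = ∏ e ∈ pathEdges A, f e.2 e.1 := by
  rw [prod_pathEdges A (fun e => f e.2 e.1), walkWeight]

lemma pow_card_inter_le_walkWeight {N : ℝ} (hN : 1 ≤ N) {k : ℕ} (D : Finset (Fin m × Fin n))
    (A : Cyc n m k) :
    N ^ (pathEdges A ∩ D).card ≤ walkWeight (stepWeight N D) A.1 A.2 := by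
  rw [walkWeight_eq_prod_pathEdges]
  calc N ^ (pathEdges A ∩ D).card = ∏ e ∈ pathEdges A, if e ∈ D then N else 1 := by
        rw [← Finset.prod_filter, Finset.prod_const, Finset.filter_mem_eq_inter]
    _ ≤ _ := by
        refine Finset.prod_le_prod (fun e _ => ?_) fun e _ => ?_
        · split_ifs <;> linarith
        · simp only [stepWeight]
          split_ifs <;> simp

lemma sum_cyc_le_sum_fun {k : ℕ} (f : (Fin (k + 1) → Fin n) → (Fin (k + 1) → Fin m) → ℝ)
    (hf : ∀ i j, 0 ≤ f i j) :
    ∑ A : Cyc n m k, f A.1 A.2 ≤ ∑ i, ∑ j, f i j := by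
  let φ : Cyc n m k ↪ (Fin (k + 1) → Fin n) × (Fin (k + 1) → Fin m) :=
    ⟨fun A => (A.1, A.2), fun A B h => Prod.ext (DFunLike.coe_injective (congrArg Prod.fst h))
      (DFunLike.coe_injective (congrArg Prod.snd h))⟩
  rw [← Fintype.sum_prod_type' f]
  calc ∑ A : Cyc n m k, f A.1 A.2 = ∑ p ∈ Finset.univ.map φ, f p.1 p.2 := by
        rw [Finset.sum_map]; rfl
    _ ≤ _ := Finset.sum_le_univ_sum_of_nonneg fun p => hf _ _

lemma stepWeight_nonneg {N : ℝ} (hN : 0 ≤ N) (D : Finset (Fin m × Fin n)) (a : Fin n) (c : Fin m) :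
    0 ≤ stepWeight N D a c := by
  simp only [stepWeight]; split_ifs <;> linarith

lemma walkWeight_nonneg {f : Fin n → Fin m → ℝ} (hf : ∀ a c, 0 ≤ f a c) {k : ℕ}
    (i : Fin (k + 1) → Fin n) (j : Fin (k + 1) → Fin m) : 0 ≤ walkWeight f i j :=
  mul_nonneg (Finset.prod_nonneg fun _ _ => hf _ _) (Finset.prod_nonneg fun _ _ => hf _ _)

lemma walkWeight_mono {f g : Fin n → Fin m → ℝ} (hf : ∀ a c, 0 ≤ f a c) (hfg : ∀ a c, f a c ≤ g a c)
    {k : ℕ} (i : Fin (k + 1) → Fin n) (j : Fin (k + 1) → Fin m) :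
    walkWeight f i j ≤ walkWeight g i j :=
  mul_le_mul (Finset.prod_le_prod (fun _ _ => hf _ _) fun _ _ => hfg _ _)
    (Finset.prod_le_prod (fun _ _ => hf _ _) fun _ _ => hfg _ _)
    (Finset.prod_nonneg fun _ _ => hf _ _)
    (Finset.prod_nonneg fun _ _ => (hf _ _).trans (hfg _ _))

/-- Weighted count of the paths, with weight `N` for each edge in a set `D` of bounded degree. -/
lemma sum_pow_card_inter_le {N : ℝ} (hN : 1 ≤ N) (hm : (m : ℝ) ≤ N) (hn : (n : ℝ) ≤ N)
    {D : Finset (Fin m × Fin n)} {d : ℕ}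
    (hrow : ∀ a, (Finset.univ.filter fun c => (c, a) ∈ D).card ≤ d)
    (hcol : ∀ c, (Finset.univ.filter fun a => (c, a) ∈ D).card ≤ d) (k : ℕ) :
    ∑ A : Cyc n m k, N ^ (pathEdges A ∩ D).card ≤ N * ((d + 1) * N) ^ (2 * k + 1) := by
  have hN0 : 0 ≤ N := zero_le_one.trans hN
  have hR : 0 ≤ ((d : ℝ) + 1) * N := by positivity
  calc ∑ A : Cyc n m k, N ^ (pathEdges A ∩ D).card
      ≤ ∑ A : Cyc n m k, walkWeight (stepWeight N D) A.1 A.2 :=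
        Finset.sum_le_sum fun A _ => pow_card_inter_le_walkWeight hN D A
    _ ≤ ∑ i : Fin (k + 1) → Fin n, ∑ j : Fin (k + 1) → Fin m, walkWeight (stepWeight N D) i j :=
        sum_cyc_le_sum_fun _ fun i j => walkWeight_nonneg (stepWeight_nonneg hN0 D) i j
    _ = ∑ b, ∑ a, walkSum (stepWeight N D) k a b := by
        have sw {α β γ : Type} [Fintype α] [Fintype β] [Fintype γ] (f : α → β → γ → ℝ) :
            ∑ a, ∑ b, ∑ c, f a b c = ∑ c, ∑ a, ∑ b, f a b c := by
          rw [Finset.sum_comm (γ := γ)]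
          exact Finset.sum_congr rfl fun a _ => Finset.sum_comm
        have hw (i : Fin (k + 1) → Fin n) (j : Fin (k + 1) → Fin m) :
            walkWeight (stepWeight N D) i j = ∑ b, ∑ a,
              if i 0 = a ∧ j (Fin.last k) = b then walkWeight (stepWeight N D) i j else 0 := by
          simp [ite_and]
        simp only [← sum_walkWeight]
        conv_lhs => enter [2, i, 2, j]; rw [hw]
        rw [sw]
        refine Finset.sum_congr rfl fun b _ => sw _
    _ ≤ ∑ _b : Fin m, ((d + 1) * N) ^ (2 * k + 1) :=
        Finset.sum_le_sum fun b _ => sum_walkSum_le (stepWeight_nonneg hN0 D) hR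
          (fun a => sum_stepWeight_row_le hm hN0 (hrow a))
          (fun c => sum_stepWeight_col_le hn hN0 (hcol c)) k b
    _ = m * ((d + 1) * N) ^ (2 * k + 1) := by simp
    _ ≤ _ := mul_le_mul_of_nonneg_right hm (by positivity)

/-- The same count for the paths with given end points that are not contained in `D`. -/
lemma sum_pow_card_inter_le_of_end {N : ℝ} (hN : 1 ≤ N) (hm : (m : ℝ) ≤ N) (hn : (n : ℝ) ≤ N)
    {D : Finset (Fin m × Fin n)} {d : ℕ}
    (hrow : ∀ a, (Finset.univ.filter fun c => (c, a) ∈ D).card ≤ d)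
    (hcol : ∀ c, (Finset.univ.filter fun a => (c, a) ∈ D).card ≤ d) (k : ℕ)
    (e : Fin m × Fin n) :
    ∑ A : Cyc n m k, (if cycEnd A = e ∧ ¬ pathEdges A ⊆ D then N ^ (pathEdges A ∩ D).card else 0)
      ≤ (2 * k + 1) * ((d + 1) * N) ^ (2 * k) := by
  have hN0 : 0 ≤ N := zero_le_one.trans hN
  have hR : 0 ≤ ((d : ℝ) + 1) * N := by positivity
  let Y : Fin n → Fin m → ℝ := fun a c => if (c, a) ∈ D then N else 0
  have hY : ∀ a c, 0 ≤ Y a c := fun a c => by simp only [Y]; split_ifs <;> linarith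
  have hYM : ∀ a c, Y a c ≤ stepWeight N D a c := fun a c => by simp [Y, stepWeight]
  calc _ ≤ ∑ A : Cyc n m k, (if A.1 0 = e.2 ∧ A.2 (Fin.last k) = e.1 then
          walkWeight (stepWeight N D) A.1 A.2 - walkWeight Y A.1 A.2 else 0) := by
        refine Finset.sum_le_sum fun A _ => ?_
        have hsub := sub_nonneg.2 (walkWeight_mono hY hYM A.1 A.2)
        have hend : cycEnd A = e ↔ A.1 0 = e.2 ∧ A.2 (Fin.last k) = e.1 := by
          rw [cycEnd, Prod.ext_iff]; exact and_comm
        by_cases h1 : cycEnd A = e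
        · rw [if_pos (hend.1 h1)]
          by_cases h2 : pathEdges A ⊆ D
          · rw [if_neg fun h => h.2 h2]; exact hsub
          · rw [if_pos ⟨h1, h2⟩]
            obtain ⟨e', he', heD⟩ := Finset.not_subset.1 h2
            have h0 : walkWeight Y A.1 A.2 = 0 := by
              rw [walkWeight_eq_prod_pathEdges]
              exact Finset.prod_eq_zero he' (by simp [Y, heD])
            rw [h0, sub_zero]
            exact pow_card_inter_le_walkWeight hN D A
        · rw [if_neg fun h => h1 h.1, if_neg fun h => h1 (hend.2 h)]
    _ ≤ ∑ i : Fin (k + 1) → Fin n, ∑ j : Fin (k + 1) → Fin m,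
          (if i 0 = e.2 ∧ j (Fin.last k) = e.1 then
            walkWeight (stepWeight N D) i j - walkWeight Y i j else 0) := by
        refine sum_cyc_le_sum_fun (fun i j => if i 0 = e.2 ∧ j (Fin.last k) = e.1 then
            walkWeight (stepWeight N D) i j - walkWeight Y i j else 0) fun i j => ?_
        split_ifs
        · exact sub_nonneg.2 (walkWeight_mono hY hYM i j)
        · exact le_rfl
    _ = walkSum (stepWeight N D) k e.2 e.1 - walkSum Y k e.2 e.1 := by
        rw [← sum_walkWeight, ← sum_walkWeight]
        simp only [← Finset.sum_sub_distrib]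
        refine Finset.sum_congr rfl fun i _ => Finset.sum_congr rfl fun j _ => ?_
        split_ifs <;> simp
    _ ≤ _ := walkSum_sub_le hY (fun a c => rfl) hR
          (fun a => sum_stepWeight_row_le hm hN0 (hrow a))
          (fun c => sum_stepWeight_col_le hn hN0 (hcol c)) k _ _

end Counting

/-! ### Second moments of sums -/

section SecondMoment

variable {ι : Type*}

lemma eval_prod_X_eq_sqfree (P : Finset ι) (x : ι → ℝ) :
    MvPolynomial.eval x (∏ e ∈ P, MvPolynomial.X e) = sqfree P x := by
  simp [sqfree]

/-- An `L¹` bound from an `L²` bound. -/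
lemma integral_abs_le_of_integral_sq_le {Ω : Type*} [MeasurableSpace Ω] {μ : Measure Ω}
    [IsProbabilityMeasure μ] {f : Ω → ℝ} {v : ℝ} (hv : 0 < v)
    (hf : Integrable f μ) (hf2 : Integrable (fun x => f x ^ 2) μ) (h : ∫ x, f x ^ 2 ∂μ ≤ v ^ 2) :
    ∫ x, |f x| ∂μ ≤ v := by
  have h1 : ∫ x, |f x| ∂μ ≤ ∫ x, (1 / (2 * v)) * (v ^ 2 + f x ^ 2) ∂μ := by
    refine integral_mono hf.abs (((integrable_const _).add hf2).const_mul _) fun x => ?_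
    have : |f x| * (2 * v) ≤ v ^ 2 + f x ^ 2 := by
      rw [← sq_abs (f x)]; nlinarith [sq_nonneg (|f x| - v)]
    simp only
    rw [one_div, inv_mul_eq_div, le_div_iff₀ (by positivity)]
    exact this
  refine h1.trans ?_
  rw [integral_const_mul, integral_add (integrable_const _) hf2]
  simp only [integral_const, probReal_univ, smul_eq_mul, one_mul]
  rw [one_div, inv_mul_eq_div, div_le_iff₀ (by positivity)]
  nlinarith

lemma integral_sq_sum_sub {κ : Type*} (s : Finset κ) {Ω : Type*} [MeasurableSpace Ω]
    {μ : Measure Ω} [IsProbabilityMeasure μ] (f : κ → Ω → ℝ) (hf : ∀ p, Integrable (f p) μ)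
    (hff : ∀ p q, Integrable (fun x => f p x * f q x) μ) :
    ∫ x, (∑ p ∈ s, f p x - ∑ p ∈ s, ∫ y, f p y ∂μ) ^ 2 ∂μ
      = ∑ p ∈ s, ∑ q ∈ s, (∫ x, f p x * f q x ∂μ - (∫ x, f p x ∂μ) * ∫ x, f q x ∂μ) := by
  have h1 : ∀ x, (∑ p ∈ s, f p x - ∑ p ∈ s, ∫ y, f p y ∂μ) ^ 2
      = ∑ p ∈ s, ∑ q ∈ s, (f p x - ∫ y, f p y ∂μ) * (f q x - ∫ y, f q y ∂μ) := fun x => by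
    rw [← Finset.sum_sub_distrib, sq, Finset.sum_mul_sum]
  have e : ∀ p q x, (f p x - ∫ y, f p y ∂μ) * (f q x - ∫ y, f q y ∂μ)
      = f p x * f q x - ((∫ y, f q y ∂μ) * f p x + (∫ y, f p y ∂μ) * f q x
          - (∫ y, f p y ∂μ) * ∫ y, f q y ∂μ) := fun p q x => by ring
  have i1 : ∀ p q, Integrable (fun x => (∫ y, f q y ∂μ) * f p x + (∫ y, f p y ∂μ) * f q x) μ :=
    fun p q => ((hf p).const_mul _).add ((hf q).const_mul _)
  have i2 : ∀ p q, Integrable (fun x => (∫ y, f q y ∂μ) * f p x + (∫ y, f p y ∂μ) * f q x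
          - (∫ y, f p y ∂μ) * ∫ y, f q y ∂μ) μ := fun p q => (i1 p q).sub (integrable_const _)
  have i3 : ∀ p q, Integrable (fun x => (f p x - ∫ y, f p y ∂μ) * (f q x - ∫ y, f q y ∂μ)) μ :=
    fun p q => by simp only [e]; exact (hff p q).sub (i2 p q)
  simp only [h1]
  rw [integral_finsetSum _ fun p _ => integrable_finsetSum _ fun q _ => i3 p q]
  refine Finset.sum_congr rfl fun p _ => ?_
  rw [integral_finsetSum _ fun q _ => i3 p q]
  refine Finset.sum_congr rfl fun q _ => ?_
  simp only [e]
  rw [integral_sub (hff p q) (i2 p q), integral_sub (i1 p q) (integrable_const _),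
    integral_add ((hf p).const_mul _) ((hf q).const_mul _), integral_const_mul, integral_const_mul]
  simp only [integral_const, probReal_univ, smul_eq_mul, one_mul]
  ring

end SecondMoment

/-! ### Correlated pairs of paths -/

section PairCounting

variable {n m : ℕ}

lemma card_union_pathEdges_row {k l : ℕ} (A : Cyc n m k) (B : Cyc n m l) (i : Fin n) :
    (Finset.univ.filter fun j => (j, i) ∈ pathEdges A ∪ pathEdges B).card ≤ 4 := by
  simp only [Finset.mem_union, Finset.filter_or]
  exact (Finset.card_union_le _ _).trans
    (add_le_add (card_pathEdges_row A i) (card_pathEdges_row B i))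

lemma card_union_pathEdges_col {k l : ℕ} (A : Cyc n m k) (B : Cyc n m l) (j : Fin m) :
    (Finset.univ.filter fun i => (j, i) ∈ pathEdges A ∪ pathEdges B).card ≤ 4 := by
  simp only [Finset.mem_union, Finset.filter_or]
  exact (Finset.card_union_le _ _).trans
    (add_le_add (card_pathEdges_col A j) (card_pathEdges_col B j))

/-- If two pairs of sets have the same cardinalities and the same symmetric difference, then the
first set of the second pair is covered by its trace on the first pair, up to `#(P ∩ Q)`
elements. -/
lemma card_le_of_symmDiff_eq {ι : Type*} [DecidableEq ι] {P Q P' Q' : Finset ι}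
    (hP : P'.card = P.card) (hQ : Q'.card = Q.card) (h : symmDiff P Q = symmDiff P' Q') :
    P'.card ≤ (P' ∩ (P ∪ Q)).card + (Q ∩ P).card := by
  have key : ∀ S T : Finset ι, (symmDiff S T).card + 2 * (S ∩ T).card = S.card + T.card := by
    intro S T
    have h1 : (symmDiff S T).card = (S \ T).card + (T \ S).card := by
      rw [symmDiff_def, Finset.sup_eq_union, Finset.card_union_of_disjoint disjoint_sdiff_sdiff]
    have h2 := Finset.card_sdiff_add_card_inter S T
    have h3 := Finset.card_sdiff_add_card_inter T S
    rw [Finset.inter_comm T S] at h3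
    omega
  have h1 := key P Q
  have h2 := key P' Q'
  rw [← h] at h2
  have h3 : P' ⊆ (P' ∩ (P ∪ Q)) ∪ (P' ∩ Q') := by
    intro e he
    by_cases hq : e ∈ Q'
    · exact Finset.mem_union_right _ (Finset.mem_inter.2 ⟨he, hq⟩)
    · have : e ∈ symmDiff P Q := by rw [h, Finset.mem_symmDiff]; exact Or.inl ⟨he, hq⟩
      refine Finset.mem_union_left _ (Finset.mem_inter.2 ⟨he, ?_⟩)
      rcases Finset.mem_symmDiff.1 this with h | h
      · exact Finset.mem_union_left _ h.1
      · exact Finset.mem_union_right _ h.1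
  have h4 := (Finset.card_le_card h3).trans (Finset.card_union_le _ _)
  rw [Finset.inter_comm Q P]
  omega

/-- The pairs of path pairs whose monomials may be correlated. -/
def Correlated {k l : ℕ} (p p' : Cyc n m k × Cyc n m l) : Prop :=
  symmDiff (pathEdges p.1) (pathEdges p.2) = symmDiff (pathEdges p'.1) (pathEdges p'.2) ∧
    (pathEdges p.1 ≠ pathEdges p.2 ∨ ¬Disjoint (pathEdges p.1) (pathEdges p'.1))

open Classical in
/-- Given the first pair and the first path of the second pair, the second path of the second pair
is determined by the symmetric difference and its end points. -/
lemma sum_correlated_last_le {k l : ℕ} (p : Cyc n m k × Cyc n m l) (A' : Cyc n m k) :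
    ∑ B' : Cyc n m l, (if cycEnd A' = cycEnd B' ∧ Correlated p (A', B') then (1 : ℝ) else 0)
      ≤ if pathEdges p.1 = pathEdges p.2 then
          (if Disjoint (pathEdges p.1) (pathEdges A') then 0 else 1)
        else if 2 * k + 1 ≤ (pathEdges A' ∩ (pathEdges p.1 ∪ pathEdges p.2)).card
            + (pathEdges p.2 ∩ pathEdges p.1).card then 1 else 0 := by
  by_cases hex : ∃ B' : Cyc n m l, cycEnd A' = cycEnd B' ∧ Correlated p (A', B')
  · obtain ⟨B', hB1, hB2⟩ := hex
    have hR : (1 : ℝ) ≤ if pathEdges p.1 = pathEdges p.2 then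
          (if Disjoint (pathEdges p.1) (pathEdges A') then 0 else 1)
        else if 2 * k + 1 ≤ (pathEdges A' ∩ (pathEdges p.1 ∪ pathEdges p.2)).card
            + (pathEdges p.2 ∩ pathEdges p.1).card then 1 else 0 := by
      by_cases hPQ : pathEdges p.1 = pathEdges p.2
      · rw [if_pos hPQ, if_neg (hB2.2.resolve_left fun h => h hPQ)]
      · rw [if_neg hPQ, if_pos]
        have := card_le_of_symmDiff_eq (by rw [card_pathEdges, card_pathEdges])
          (by rw [card_pathEdges, card_pathEdges]) hB2.1
        rwa [card_pathEdges A'] at this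
    refine le_trans ?_ hR
    rw [← Finset.sum_filter, Finset.sum_const, nsmul_eq_mul, mul_one]
    norm_cast
    refine Finset.card_le_one.2 fun B₁ h₁ B₂ h₂ => ?_
    rw [Finset.mem_filter] at h₁ h₂
    refine eq_of_pathEdges_subset _ _ (h₁.2.1.symm.trans h₂.2.1) (le_of_eq ?_)
    exact symmDiff_right_injective (pathEdges A') (h₁.2.2.1.symm.trans h₂.2.2.1)
  · rw [Finset.sum_eq_zero fun B' _ => if_neg fun h => hex ⟨B', h⟩]
    split_ifs <;> norm_num

open Classical in
/-- The number of correlated pairs of path pairs. The bound is of the order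
`N ^ (2k + 2l + 3)`, one factor `N` below the square `(n m) ^ (k + l + 2)` of the normalization. -/
lemma sum_correlated_le {N : ℝ} (hN : 1 ≤ N) (hm : (m : ℝ) ≤ N) (hn : (n : ℝ) ≤ N) (k l : ℕ) :
    ∑ A : Cyc n m k, ∑ B : Cyc n m l, (if cycEnd A = cycEnd B then
        ∑ A' : Cyc n m k, ∑ B' : Cyc n m l,
          (if cycEnd A' = cycEnd B' ∧ Correlated (A, B) (A', B') then (1 : ℝ) else 0) else 0)
      ≤ N ^ (2 * k + 2 * l + 3) * (5 ^ (2 * k + 1) * (2 * l + 1) * 3 ^ (2 * l) + 3 ^ (2 * l + 1)) := by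
  have hN0 : 0 < N := zero_lt_one.trans_le hN
  -- the sum over the second pair
  have s1 (A : Cyc n m k) (B : Cyc n m l) : ∑ A' : Cyc n m k, ∑ B' : Cyc n m l,
        (if cycEnd A' = cycEnd B' ∧ Correlated (A, B) (A', B') then (1 : ℝ) else 0)
      ≤ if pathEdges A = pathEdges B then (3 * N) ^ (2 * k + 1)
        else 5 ^ (2 * k + 1) * N * N ^ (pathEdges B ∩ pathEdges A).card := by
    refine (Finset.sum_le_sum fun A' _ => sum_correlated_last_le (A, B) A').trans ?_
    by_cases hPQ : pathEdges A = pathEdges B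
    · simp only [if_pos hPQ]
      have h1 := sum_pow_card_inter_le hN hm hn (D := pathEdges A) (d := 2)
        (card_pathEdges_row A) (card_pathEdges_col A) k
      refine (Finset.sum_le_sum (g := fun A' => N⁻¹ * N ^ (pathEdges A' ∩ pathEdges A).card)
        fun A' _ => ?_).trans ?_
      · -- `A'` shares an edge with `A`, so one factor `N` of its weight can be divided out
        split_ifs with hd
        · positivity
        · have : 1 ≤ (pathEdges A' ∩ pathEdges A).card := by
            rw [Finset.one_le_card, ← Finset.not_disjoint_iff_nonempty_inter]
            exact fun h => hd h.symm
          rw [inv_mul_eq_div, le_div_iff₀ hN0, one_mul]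
          exact le_self_pow₀ hN (by omega)
      · rw [← Finset.mul_sum, inv_mul_eq_div, div_le_iff₀ hN0]
        refine h1.trans (le_of_eq ?_)
        norm_num; ring
    · simp only [if_neg hPQ]
      have h1 := sum_pow_card_inter_le hN hm hn (D := pathEdges A ∪ pathEdges B) (d := 4)
        (card_union_pathEdges_row A B) (card_union_pathEdges_col A B) k
      refine (Finset.sum_le_sum (g := fun A' => (N ^ (2 * k + 1))⁻¹
        * N ^ (pathEdges B ∩ pathEdges A).card
        * N ^ (pathEdges A' ∩ (pathEdges A ∪ pathEdges B)).card) fun A' _ => ?_).trans ?_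
      · -- all edges of `A'` but at most `#(Q ∩ P)` of them carry a factor `N`
        split_ifs with hd
        · rw [mul_assoc, ← pow_add, inv_mul_eq_div, le_div_iff₀ (by positivity), one_mul]
          exact pow_le_pow_right₀ hN (by omega)
        · positivity
      · rw [← Finset.mul_sum]
        refine (mul_le_mul_of_nonneg_left h1 (by positivity)).trans (le_of_eq ?_)
        have : N ^ (2 * k + 1) ≠ 0 := by positivity
        rw [mul_pow]
        field_simp
        norm_num
  -- the sum over the second path of the first pair
  have s2 (A : Cyc n m k) : ∑ B : Cyc n m l, (if cycEnd A = cycEnd B then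
        ∑ A' : Cyc n m k, ∑ B' : Cyc n m l,
          (if cycEnd A' = cycEnd B' ∧ Correlated (A, B) (A', B') then (1 : ℝ) else 0) else 0)
      ≤ 5 ^ (2 * k + 1) * N * ((2 * l + 1) * (3 * N) ^ (2 * l)) + (3 * N) ^ (2 * l + 1) := by
    have h1 := sum_pow_card_inter_le_of_end hN hm hn (D := pathEdges A) (d := 2)
        (card_pathEdges_row A) (card_pathEdges_col A) l (cycEnd A)
    have h2 : ∑ B : Cyc n m l, (if cycEnd A = cycEnd B ∧ pathEdges A = pathEdges B then
        (3 * N) ^ (2 * k + 1) else 0) ≤ (3 * N) ^ (2 * l + 1) := by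
      by_cases hex : ∃ B : Cyc n m l, cycEnd A = cycEnd B ∧ pathEdges A = pathEdges B
      · obtain ⟨B, hB1, hB2⟩ := hex
        obtain rfl := length_eq_of_pathEdges_subset A B hB1 hB2.le
        rw [Finset.sum_eq_single B]
        · rw [if_pos ⟨hB1, hB2⟩]
        · intro B' _ hB'
          refine if_neg fun h => hB' ?_
          exact eq_of_pathEdges_subset _ _ (h.1.symm.trans hB1) (h.2.symm.trans hB2).le
        · simp
      · rw [Finset.sum_eq_zero fun B _ => if_neg fun h => hex ⟨B, h⟩]
        positivity
    calc _ ≤ ∑ B : Cyc n m l, (5 ^ (2 * k + 1) * N * (if cycEnd B = cycEnd A ∧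
            ¬ pathEdges B ⊆ pathEdges A then N ^ (pathEdges B ∩ pathEdges A).card else 0)
          + if cycEnd A = cycEnd B ∧ pathEdges A = pathEdges B then
            (3 * N) ^ (2 * k + 1) else 0) := by
          refine Finset.sum_le_sum fun B _ => ?_
          by_cases he : cycEnd A = cycEnd B
          · rw [if_pos he]
            refine (s1 A B).trans ?_
            by_cases hPQ : pathEdges A = pathEdges B
            · rw [if_pos hPQ, if_pos (And.intro he hPQ)]
              refine le_add_of_nonneg_left (mul_nonneg (by positivity) ?_)
              split_ifs <;> positivity
            · have hns : ¬ pathEdges B ⊆ pathEdges A := fun h => by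
                obtain rfl := length_eq_of_pathEdges_subset B A he.symm h
                exact hPQ (congrArg pathEdges (eq_of_pathEdges_subset B A he.symm h)).symm
              rw [if_neg hPQ, if_pos ⟨he.symm, hns⟩, if_neg fun h => hPQ h.2, add_zero]
          · rw [if_neg he, if_neg (fun h => he h.1.symm), if_neg fun h => he h.1]
            simp
      _ ≤ _ := by
          rw [Finset.sum_add_distrib, ← Finset.mul_sum]
          refine add_le_add (mul_le_mul_of_nonneg_left (h1.trans (le_of_eq ?_)) (by positivity)) h2
          norm_num
  refine (Finset.sum_le_sum fun A _ => s2 A).trans ?_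
  rw [Finset.sum_const, nsmul_eq_mul]
  have hcard : ((Finset.univ : Finset (Cyc n m k)).card : ℝ) ≤ N ^ (2 * k + 2) := by
    rw [Finset.card_univ, Fintype.card_prod, Fintype.card_embedding_eq, Fintype.card_embedding_eq]
    simp only [Fintype.card_fin]
    calc ((n.descFactorial (k + 1) * m.descFactorial (k + 1) : ℕ) : ℝ)
        ≤ ((n ^ (k + 1) * m ^ (k + 1) : ℕ) : ℝ) := by
          exact_mod_cast Nat.mul_le_mul (Nat.descFactorial_le_pow _ _) (Nat.descFactorial_le_pow _ _)
      _ ≤ N ^ (k + 1) * N ^ (k + 1) := by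
          push_cast
          gcongr
      _ = _ := by ring
  refine (mul_le_mul_of_nonneg_right hcard (by positivity)).trans (le_of_eq ?_)
  rw [mul_pow, mul_pow]
  ring

open Classical in
/-- The variance of the sum over pairs of paths; its mean is the number of pairs of equal paths. -/
lemma integral_sq_pathPairSum_le {N : ℝ} (hN : 1 ≤ N) (hm : (m : ℝ) ≤ N) (hn : (n : ℝ) ≤ N)
    (k l : ℕ) :
    ∫ x, (pathPairSum n m k l x - if k = l then
        (n.descFactorial (k + 1) * m.descFactorial (k + 1) : ℝ) else 0) ^ 2 ∂(stdPi (Fin m × Fin n))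
      ≤ 3 ^ (2 * k + 1) * (N ^ (2 * k + 2 * l + 3)
        * (5 ^ (2 * k + 1) * (2 * l + 1) * 3 ^ (2 * l) + 3 ^ (2 * l + 1))) := by
  let s : Finset (Cyc n m k × Cyc n m l) := Finset.univ.filter fun p => cycEnd p.1 = cycEnd p.2
  let f : Cyc n m k × Cyc n m l → (Fin m × Fin n → ℝ) → ℝ :=
    fun p x => sqfree (pathEdges p.1) x * sqfree (pathEdges p.2) x
  have hS : ∀ x, pathPairSum n m k l x = ∑ p ∈ s, f p x := fun x => by
    rw [pathPairSum, Finset.sum_filter]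
    exact (Fintype.sum_prod_type fun p : Cyc n m k × Cyc n m l =>
      if cycEnd p.1 = cycEnd p.2 then f p x else 0).symm
  have hf : ∀ p, Integrable (f p) (stdPi (Fin m × Fin n)) := fun p => by
    refine (integrable_eval_stdPi ((∏ e ∈ pathEdges p.1, MvPolynomial.X e)
      * ∏ e ∈ pathEdges p.2, MvPolynomial.X e)).congr (ae_of_all _ fun x => ?_)
    simp only [map_mul, eval_prod_X_eq_sqfree, f]
  have hff : ∀ p q, Integrable (fun x => f p x * f q x) (stdPi (Fin m × Fin n)) := fun p q => by
    refine (integrable_eval_stdPi (((∏ e ∈ pathEdges p.1, MvPolynomial.X e)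
      * ∏ e ∈ pathEdges p.2, MvPolynomial.X e) * ((∏ e ∈ pathEdges q.1, MvPolynomial.X e)
      * ∏ e ∈ pathEdges q.2, MvPolynomial.X e))).congr (ae_of_all _ fun x => ?_)
    simp only [map_mul, eval_prod_X_eq_sqfree, f]
  have hmean : (∑ p ∈ s, ∫ y, f p y ∂(stdPi (Fin m × Fin n))) = if k = l then
        (n.descFactorial (k + 1) * m.descFactorial (k + 1) : ℝ) else 0 := by
    have h1 : ∀ p, ∫ y, f p y ∂(stdPi (Fin m × Fin n))
        = if pathEdges p.1 = pathEdges p.2 then 1 else 0 := fun p => integral_sqfree_two _ _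
    simp only [h1, s]
    rw [Finset.sum_filter, Fintype.sum_prod_type]
    by_cases hkl : k = l
    · subst hkl
      have h2 : ∀ A : Cyc n m k, ∑ B : Cyc n m k, (if cycEnd A = cycEnd B then
          (if pathEdges A = pathEdges B then (1 : ℝ) else 0) else 0) = 1 := fun A => by
        rw [Finset.sum_eq_single A]
        · simp
        · intro B _ hB
          by_cases he : cycEnd A = cycEnd B
          · rw [if_pos he, if_neg fun h => hB (eq_of_pathEdges_subset A B he h.le).symm]
          · rw [if_neg he]
        · simp
      simp only [h2, if_true]
      simp [Fintype.card_embedding_eq]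
    · rw [if_neg hkl]
      refine Finset.sum_eq_zero fun A _ => Finset.sum_eq_zero fun B _ => ?_
      by_cases he : cycEnd A = cycEnd B
      · rw [if_pos he, if_neg fun h => hkl (length_eq_of_pathEdges_subset A B he h.le)]
      · rw [if_neg he]
  rw [← hmean]
  simp only [hS]
  rw [integral_sq_sum_sub s f hf hff]
  refine le_trans ?_ (mul_le_mul_of_nonneg_left (sum_correlated_le (n := n) (m := m) hN hm hn k l)
    (by positivity))
  have h1 : ∀ p q, ∫ x, f p x * f q x ∂(stdPi (Fin m × Fin n))
      - (∫ x, f p x ∂(stdPi (Fin m × Fin n))) * ∫ x, f q x ∂(stdPi (Fin m × Fin n))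
      ≤ 3 ^ (2 * k + 1) * if Correlated p q then (1 : ℝ) else 0 := by
    intro p q
    refine (le_abs_self _).trans ((abs_cov_sqfree_le _ _ _ _).trans (le_of_eq ?_))
    rw [card_pathEdges, mul_ite, mul_one, mul_zero]
    exact if_congr Iff.rfl rfl rfl
  refine (Finset.sum_le_sum fun p _ => Finset.sum_le_sum fun q _ => h1 p q).trans (le_of_eq ?_)
  simp only [← Finset.mul_sum, s]
  congr 1
  rw [Finset.sum_filter, Fintype.sum_prod_type]
  refine Finset.sum_congr rfl fun A _ => Finset.sum_congr rfl fun B _ => ?_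
  congr 1
  rw [Finset.sum_filter, Fintype.sum_prod_type]
  refine Finset.sum_congr rfl fun A' _ => Finset.sum_congr rfl fun B' _ => ?_
  rw [ite_and]

end PairCounting

/-! ### The distance of the Stein matrix from the identity -/

section SteinBound

variable {n m : ℕ}

lemma one_sub_le_descFactorial_div_pow {r : ℕ} (hn : 0 < n) :
    1 - (r : ℝ) ^ 2 / n ≤ (n.descFactorial r : ℝ) / n ^ r ∧
      (n.descFactorial r : ℝ) / n ^ r ≤ 1 := by
  have hn' : (0 : ℝ) < n := by exact_mod_cast hn
  constructor
  · by_cases hr : r ≤ n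
    · have h1 : ((n + 1 - r : ℕ) : ℝ) ^ r ≤ n.descFactorial r := by
        exact_mod_cast Nat.pow_sub_le_descFactorial n r
      have h2 : (n : ℝ) - r ≤ ((n + 1 - r : ℕ) : ℝ) := by
        rw [Nat.cast_sub (by omega)]; push_cast; linarith
      have hr' : (r : ℝ) ≤ n := by exact_mod_cast hr
      have h3 : 1 + (r : ℝ) * (-(r / n)) ≤ (1 + -((r : ℝ) / n)) ^ r := by
        refine one_add_mul_le_pow ?_ r
        have : (r : ℝ) / n ≤ 1 := (div_le_one hn').2 hr'
        linarith
      calc 1 - (r : ℝ) ^ 2 / n = 1 + (r : ℝ) * (-(r / n)) := by ring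
        _ ≤ (1 + -((r : ℝ) / n)) ^ r := h3
        _ = ((n : ℝ) - r) ^ r / n ^ r := by rw [← div_pow]; congr 1; field_simp; ring
        _ ≤ _ := by
          gcongr
          exact (pow_le_pow_left₀ (by linarith) h2 r).trans h1
    · have hr' : (n : ℝ) < r := by exact_mod_cast not_le.1 hr
      have h1 : 1 ≤ (r : ℝ) ^ 2 / n := by
        rw [le_div_iff₀ hn']
        have : (1 : ℝ) ≤ n := by exact_mod_cast hn
        nlinarith
      have h2 : (0 : ℝ) ≤ (n.descFactorial r : ℝ) / n ^ r := by positivity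
      linarith
  · rw [div_le_one (by positivity)]
    exact_mod_cast Nat.descFactorial_le_pow n r

lemma one_div_sqrt_pow_sq {t : ℝ} (ht : 0 ≤ t) (p : ℕ) : ((1 / √t) ^ p) ^ 2 = 1 / t ^ p := by
  rw [← pow_mul, mul_comm p 2, pow_mul, div_pow, Real.sq_sqrt ht, one_pow, div_pow, one_pow]

lemma sq_cycleNormalization {s t a b : ℝ} (hs : 0 < s) (ht : 0 < t) (ha : 0 < a) (hb : 0 < b)
    (p : ℕ) :
    ((1 / √s) ^ p * (1 / √t) ^ p * (√(2 * b) / √(2 * a))) ^ 2 = b / a / (s * t) ^ p := by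
  have hab : (√(2 * b) / √(2 * a)) ^ 2 = b / a := by
    rw [div_pow, Real.sq_sqrt (by positivity), Real.sq_sqrt (by positivity)]
    field_simp
  rw [mul_pow, mul_pow, one_div_sqrt_pow_sq hs.le, one_div_sqrt_pow_sq ht.le, hab, mul_pow]
  field_simp

/-- The variance bound for the pair sums, after normalization: every exponent is at most of order
`K`, and one factor `n` is left in the denominator. -/
lemma normalized_variance_le {s N ρ q : ℝ} {k l K : ℕ} (hs : 0 < s) (hq : 0 < q) (hsN : s ≤ N)
    (hρ1 : 1 ≤ ρ) (hρ : N ^ 2 ≤ ρ * q) (hk : k < K) (hl : l < K) :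
    ((l : ℝ) + 1) / ((k : ℝ) + 1) / q ^ (k + 1 + (l + 1)) *
      (3 ^ (2 * k + 1) * (N ^ (2 * k + 2 * l + 3)
        * (5 ^ (2 * k + 1) * (2 * (l : ℝ) + 1) * 3 ^ (2 * l) + 3 ^ (2 * l + 1))))
      ≤ 3 * K ^ 2 * (2025 * ρ ^ 2) ^ K / s := by
  have hN0 : 0 < N := hs.trans_le hsN
  have hK' : (1 : ℝ) ≤ K := by exact_mod_cast (by omega : 1 ≤ K)
  have hlK : (l : ℝ) + 1 ≤ K := by exact_mod_cast hl
  set p : ℕ := k + 1 + (l + 1) with hp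
  have b1 : ((l : ℝ) + 1) / ((k : ℝ) + 1) / q ^ p ≤ K / q ^ p := by
    have : ((l : ℝ) + 1) / ((k : ℝ) + 1) ≤ K := by
      rw [div_le_iff₀ (by positivity)]
      have : (0 : ℝ) ≤ k := Nat.cast_nonneg _
      nlinarith
    gcongr
  have b2 : (3 : ℝ) ^ (2 * k + 1) ≤ 9 ^ K := by
    rw [show (9 : ℝ) = 3 ^ 2 by norm_num, ← pow_mul]
    exact pow_le_pow_right₀ (by norm_num) (by omega)
  have b3 : (5 : ℝ) ^ (2 * k + 1) ≤ 25 ^ K := by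
    rw [show (25 : ℝ) = 5 ^ 2 by norm_num, ← pow_mul]
    exact pow_le_pow_right₀ (by norm_num) (by omega)
  have b4 : (3 : ℝ) ^ (2 * l) ≤ 9 ^ K := by
    rw [show (9 : ℝ) = 3 ^ 2 by norm_num, ← pow_mul]
    exact pow_le_pow_right₀ (by norm_num) (by omega)
  have b5 : (3 : ℝ) ^ (2 * l + 1) ≤ 9 ^ K := by
    rw [show (9 : ℝ) = 3 ^ 2 by norm_num, ← pow_mul]
    exact pow_le_pow_right₀ (by norm_num) (by omega)
  have b6 : 5 ^ (2 * k + 1) * (2 * (l : ℝ) + 1) * 3 ^ (2 * l)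
      + 3 ^ (2 * l + 1) ≤ 3 * K * 225 ^ K := by
    have e : (225 : ℝ) ^ K = 25 ^ K * 9 ^ K := by rw [← mul_pow]; norm_num
    have h9 : (9 : ℝ) ^ K ≤ K * (25 ^ K * 9 ^ K) := by
      have : (1 : ℝ) ≤ 25 ^ K := one_le_pow₀ (by norm_num)
      have h9' : (0 : ℝ) ≤ 9 ^ K := by positivity
      have h10 : (1 : ℝ) ≤ K * 25 ^ K := by nlinarith
      nlinarith
    have h2 : 5 ^ (2 * k + 1) * (2 * (l : ℝ) + 1) * 3 ^ (2 * l)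
        ≤ 25 ^ K * (2 * K) * 9 ^ K := by
      gcongr
      linarith
    rw [e]
    nlinarith
  have b7 : N ^ (2 * k + 2 * l + 3) ≤ ρ ^ (2 * K) * q ^ p / s := by
    rw [le_div_iff₀ hs]
    calc N ^ (2 * k + 2 * l + 3) * s ≤ N ^ (2 * k + 2 * l + 3) * N := by gcongr
      _ = (N ^ 2) ^ p := by rw [← pow_succ, ← pow_mul]; congr 1; omega
      _ ≤ (ρ * q) ^ p := by gcongr
      _ = ρ ^ p * q ^ p := mul_pow _ _ _
      _ ≤ _ := by
          gcongr
          omega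
  have e9 : (2025 * ρ ^ 2) ^ K = 9 ^ K * 225 ^ K * ρ ^ (2 * K) := by
    rw [mul_pow, ← pow_mul, ← mul_pow]
    norm_num
  calc _ ≤ (K / q ^ p) * (9 ^ K * ((ρ ^ (2 * K) * q ^ p / s) * (3 * K * 225 ^ K))) := by gcongr
    _ = _ := by
        rw [e9]
        field_simp

lemma cycleNormalization_mul_descFactorial {s t c a b : ℝ} (hs : 0 < s) (ht : 0 < t) (hc : 0 < c)
    (r : ℕ) :
    (1 / √s) ^ (r + r) * (1 / √t) ^ (r + r) * (√c / √c) * (a * b) = a / s ^ r * (b / t ^ r) := by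
  have e {u : ℝ} (hu : 0 ≤ u) : (1 / √u) ^ (r + r) = 1 / u ^ r := by
    rw [← two_mul, mul_comm, pow_mul, one_div_sqrt_pow_sq hu]
  rw [div_self (Real.sqrt_pos.2 hc).ne', e hs.le, e ht.le, mul_one, mul_mul_mul_comm,
    one_div_mul_eq_div, one_div_mul_eq_div]

lemma abs_descFactorial_ratio_sub_one_le (hn : 0 < n) (hm : 0 < m) {r K : ℕ} (hr : r ≤ K) :
    |(n.descFactorial r : ℝ) / n ^ r * ((m.descFactorial r : ℝ) / m ^ r) - 1|
      ≤ (K : ℝ) ^ 2 / n + (K : ℝ) ^ 2 / m := by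
  obtain ⟨x1, x2⟩ := one_sub_le_descFactorial_div_pow (r := r) hn
  obtain ⟨y1, y2⟩ := one_sub_le_descFactorial_div_pow (r := r) hm
  have x0 : (0 : ℝ) ≤ (n.descFactorial r : ℝ) / n ^ r := by positivity
  have y0 : (0 : ℝ) ≤ (m.descFactorial r : ℝ) / m ^ r := by positivity
  have x3 : (r : ℝ) ^ 2 / n ≤ (K : ℝ) ^ 2 / n := by gcongr
  have y3 : (r : ℝ) ^ 2 / m ≤ (K : ℝ) ^ 2 / m := by gcongr
  generalize (n.descFactorial r : ℝ) / n ^ r = x at *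
  generalize (m.descFactorial r : ℝ) / m ^ r = y at *
  generalize (K : ℝ) ^ 2 / n = u at *
  generalize (K : ℝ) ^ 2 / m = v at *
  rw [abs_le]
  constructor <;> nlinarith

/-- The `L¹` distance of the entries of the Stein matrix of the cycle counts from those of the
identity. -/
lemma integral_abs_steinMatrix_sub_le (hn : 0 < n) (hm : 0 < m) {ρ : ℝ} (hρ1 : 1 ≤ ρ)
    (hρ : ((n : ℝ) + m) ^ 2 ≤ ρ * (n * m)) {K : ℕ} (k l : Fin K) :
    ∫ x, |MvPolynomial.eval x (steinMatrix (fun k : Fin K => pathCoord n m k)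
        (fun k : Fin K => cycleCoord n m k) k l) - if k = l then 1 else 0| ∂(stdPi (Fin m × Fin n))
      ≤ √(3 * K ^ 2 * (2025 * ρ ^ 2) ^ K / n) + ((K : ℝ) ^ 2 / n + (K : ℝ) ^ 2 / m) := by
  have hn' : (0 : ℝ) < n := by exact_mod_cast hn
  have hm' : (0 : ℝ) < m := by exact_mod_cast hm
  have hk := k.isLt
  have hl := l.isLt
  have hK : (0 : ℝ) < K := by exact_mod_cast (by omega : 0 < K)
  set p : ℕ := (k : ℕ) + 1 + (l + 1) with hp
  set c : ℝ := (1 / √(n : ℝ)) ^ p * (1 / √(m : ℝ)) ^ p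
    * (√(2 * ((l : ℝ) + 1)) / √(2 * ((k : ℝ) + 1))) with hc
  set T : ℝ := if (k : ℕ) = l then
    (n.descFactorial ((k : ℕ) + 1) * m.descFactorial ((k : ℕ) + 1) : ℝ) else 0 with hT
  set N : ℝ := (n : ℝ) + m with hN
  have hN1 : 1 ≤ N := by
    have : (1 : ℝ) ≤ n := by exact_mod_cast hn
    linarith
  have hN0 : 0 < N := by linarith
  have hvar := integral_sq_pathPairSum_le (n := n) (m := m) hN1 (by linarith) (by linarith) k l
  have hcsq : c ^ 2 = ((l : ℝ) + 1) / ((k : ℝ) + 1) / ((n : ℝ) * m) ^ p :=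
    sq_cycleNormalization hn' hm' (by positivity) (by positivity) p
  have hmean : |c * T - if k = l then 1 else 0| ≤ (K : ℝ) ^ 2 / n + (K : ℝ) ^ 2 / m := by
    by_cases hkl : k = l
    · subst hkl
      rw [hc, hT, if_pos rfl, if_pos rfl,
        cycleNormalization_mul_descFactorial hn' hm' (by positivity) ((k : ℕ) + 1)]
      exact abs_descFactorial_ratio_sub_one_le hn hm hk
    · have hkl' : ¬(k : ℕ) = l := fun h => hkl (Fin.ext h)
      rw [hT, if_neg hkl, if_neg hkl', mul_zero, sub_zero, abs_zero]
      positivity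
  have hpoly : Integrable (fun x => pathPairSum n m k l x) (stdPi (Fin m × Fin n)) ∧
      Integrable (fun x => (c * (pathPairSum n m k l x - T)) ^ 2) (stdPi (Fin m × Fin n)) := by
    let q : MvPolynomial (Fin m × Fin n) ℝ := ∑ A : Cyc n m k, ∑ B : Cyc n m l,
      if cycEnd A = cycEnd B then (∏ e ∈ pathEdges A, MvPolynomial.X e)
        * ∏ e ∈ pathEdges B, MvPolynomial.X e else 0
    have hq : ∀ x, MvPolynomial.eval x q = pathPairSum n m k l x := fun x => by
      simp only [q, map_sum, pathPairSum]
      refine Finset.sum_congr rfl fun A _ => Finset.sum_congr rfl fun B _ => ?_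
      split_ifs
      · rw [map_mul, eval_prod_X_eq_sqfree, eval_prod_X_eq_sqfree]
      · simp
    constructor
    · exact (integrable_eval_stdPi q).congr (ae_of_all _ hq)
    · refine (integrable_eval_stdPi ((MvPolynomial.C c * (q - MvPolynomial.C T)) ^ 2)).congr
        (ae_of_all _ fun x => ?_)
      simp [hq]
  have hi : Integrable (fun x => c * (pathPairSum n m k l x - T)) (stdPi (Fin m × Fin n)) :=
    (hpoly.1.sub (integrable_const _)).const_mul _
  have hv : 0 < √(3 * K ^ 2 * (2025 * ρ ^ 2) ^ K / n) := by
    have : 0 < ρ := by linarith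
    positivity
  have hL1 : ∫ x, |c * (pathPairSum n m k l x - T)| ∂(stdPi (Fin m × Fin n))
      ≤ √(3 * K ^ 2 * (2025 * ρ ^ 2) ^ K / n) := by
    refine integral_abs_le_of_integral_sq_le hv hi hpoly.2 ?_
    rw [Real.sq_sqrt (by positivity)]
    simp only [mul_pow c]
    rw [integral_const_mul]
    refine (mul_le_mul_of_nonneg_left hvar (sq_nonneg c)).trans ?_
    rw [hcsq]
    exact normalized_variance_le hn' (mul_pos hn' hm') (by linarith) hρ1 hρ hk hl
  calc _ ≤ ∫ x, (|c * (pathPairSum n m k l x - T)| + |c * T - if k = l then 1 else 0|)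
        ∂(stdPi (Fin m × Fin n)) := by
        refine integral_mono ((integrable_eval_stdPi _).sub (integrable_const _)).abs
          (hi.abs.add (integrable_const _)) fun x => ?_
        simp only [eval_steinMatrix_cycles]
        refine le_trans (le_of_eq ?_) (abs_add_le _ _)
        congr 1
        ring
    _ ≤ _ := by
        rw [integral_add hi.abs (integrable_const _)]
        simp only [integral_const, probReal_univ, smul_eq_mul, one_mul]
        exact add_le_add hL1 hmean

end SteinBound

/-! ### The law of the matrix entries -/

section Transfer

variable {n m : ℕ}

/-- A matrix with independent standard Gaussian rows has independent standard Gaussian entries. -/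
lemma map_entries_eq_stdPi {Ω : Type*} [MeasurableSpace Ω] {P : Measure Ω} [IsProbabilityMeasure P]
    {G : ℕ → Ω → EuclideanSpace ℝ (Fin n)}
    (hG : ∀ j, HasLaw (G j) (stdGaussian (EuclideanSpace ℝ (Fin n))) P) (hI : iIndepFun G P) :
    AEMeasurable (fun ω (e : Fin m × Fin n) => G e.1 ω e.2) P ∧
      P.map (fun ω (e : Fin m × Fin n) => G e.1 ω e.2) = stdPi (Fin m × Fin n) := by
  have hm : ∀ j : Fin m, AEMeasurable (G j) P := fun j => (hG j).aemeasurable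
  have h1 := (iIndepFun_iff_map_fun_eq_pi_map hm).1 (hI.precomp (g := ((↑) : Fin m → ℕ))
    Fin.val_injective)
  have h2 : ∀ j : Fin m, P.map (G j) = (stdPi (Fin n)).map (WithLp.toLp 2) := fun j => by
    rw [(hG j).map_eq, map_pi_eq_stdGaussian]
  have hφ : Measurable fun (y : Fin m → EuclideanSpace ℝ (Fin n)) (e : Fin m × Fin n) =>
      y e.1 e.2 := by fun_prop
  have hjoint : AEMeasurable (fun ω (j : Fin m) => G j ω) P := aemeasurable_pi_lambda _ hm
  have hu : Measurable fun (y : Fin m → Fin n → ℝ) (e : Fin m × Fin n) => y e.1 e.2 := by fun_prop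
  refine ⟨hφ.comp_aemeasurable hjoint, ?_⟩
  have h3 : P.map (fun ω (e : Fin m × Fin n) => G e.1 ω e.2)
      = (P.map fun ω (j : Fin m) => G j ω).map
        fun (y : Fin m → EuclideanSpace ℝ (Fin n)) (e : Fin m × Fin n) => y e.1 e.2 :=
    (AEMeasurable.map_map_of_aemeasurable hφ.aemeasurable hjoint).symm
  have h4 : (Measure.pi fun j : Fin m => P.map (G j))
      = (Measure.pi fun _ : Fin m => stdPi (Fin n)).map fun y j => WithLp.toLp 2 (y j) := by
    simp only [h2]
    exact (Measure.pi_map_pi fun _ => by fun_prop).symm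
  rw [h3, h1, h4, Measure.map_map hφ (by fun_prop)]
  refine (Measure.pi_eq fun s hs => ?_).symm
  have hpre : ((fun (y : Fin m → EuclideanSpace ℝ (Fin n)) (e : Fin m × Fin n) => y e.1 e.2) ∘
      fun (y : Fin m → Fin n → ℝ) j => WithLp.toLp 2 (y j)) ⁻¹' (Set.univ.pi s)
      = Set.univ.pi fun j => Set.univ.pi fun i => s (j, i) := by
    ext y
    simp only [Set.mem_preimage, Set.mem_pi, Set.mem_univ, true_imp_iff, Function.comp]
    exact ⟨fun h j i => h (j, i), fun h e => h e.1 e.2⟩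
  have hmeas : Measurable ((fun (y : Fin m → EuclideanSpace ℝ (Fin n)) (e : Fin m × Fin n) =>
      y e.1 e.2) ∘ fun (y : Fin m → Fin n → ℝ) j => WithLp.toLp 2 (y j)) := hu
  rw [Measure.map_apply hmeas (MeasurableSet.univ_pi hs), hpre, Measure.pi_pi]
  simp only [Measure.pi_pi]
  rw [Fintype.prod_prod_type]

lemma cycleVector_eq_evalVec (K : ℕ) (M : ℕ → EuclideanSpace ℝ (Fin n)) :
    cycleVector K m M
      = evalVec (fun k : Fin K => cycleCoord n m k) (fun e : Fin m × Fin n => M e.1 e.2) := by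
  ext k
  simp only [cycleVector, evalVec, eval_cycleCoord]

end Transfer

/-! ### Asymptotics in the dimension -/

section Asymptotics

open Filter

lemma alphaC_pos {κ : ℝ} (hκ : 0 < κ) : 0 < alphaC κ := by
  have hac := gaussianReal_absolutelyContinuous' 0 (v := 1) one_ne_zero
  have hs : MeasurableSet {z : ℝ | |z| ≤ κ} :=
    (isClosed_le continuous_abs continuous_const).measurableSet
  have h0 : 0 < gaussProb κ := by
    refine ENNReal.toReal_pos (fun h => ?_) (measure_ne_top _ _)
    have h1 : volume (Set.Ioo 0 κ) = 0 :=
      measure_mono_null (fun z hz => by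
        rw [Set.mem_ofPred_eq, abs_of_pos hz.1]
        exact hz.2.le) (hac h)
    simp at h1
    linarith
  have h1 : gaussProb κ < 1 := by
    have hc : 0 < (gaussianReal 0 1).real {z : ℝ | |z| ≤ κ}ᶜ := by
      refine ENNReal.toReal_pos (fun h => ?_) (measure_ne_top _ _)
      have h1 : volume (Set.Ioi κ) = 0 :=
        measure_mono_null (fun z hz => by
          rw [Set.mem_compl_iff, Set.mem_ofPred_eq, not_le]
          exact lt_of_lt_of_le hz (le_abs_self z)) (hac h)
      simp at h1
    rw [probReal_compl_eq_one_sub hs] at hc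
    exact sub_pos.1 hc
  rw [alphaC, neg_div, neg_pos]
  exact div_neg_of_pos_of_neg (Real.log_pos one_lt_two) (Real.log_neg h0 h1)

/-- The final comparison of powers, in terms of `x = n ^ (1 / 64)`. -/
lemma sq_mul_errors_le {x B α K BK n m : ℝ} (hx : 1 ≤ x) (hα : 0 < α)
    (hC : √(3 * B) + 1 + 2 / α ≤ x) (hn : n = x ^ 64) (hK : 0 ≤ K) (hKx : K ≤ x) (hBK0 : 0 ≤ BK)
    (hBK : BK ≤ B * x ^ 16) (hm : α / 2 * n ≤ m) :
    K ^ 2 * (√(3 * K ^ 2 * BK / n) + (K ^ 2 / n + K ^ 2 / m)) ≤ (x ^ 16)⁻¹ := by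
  have hx0 : 0 < x := by linarith
  have hn0 : 0 < n := by rw [hn]; positivity
  have hm0 : 0 < m := lt_of_lt_of_le (by positivity) hm
  have e1 : √(3 * K ^ 2 * BK / n) ≤ √(3 * B) / x ^ 23 := by
    rw [← Real.sqrt_sq (by positivity : 0 ≤ x ^ 23), ← Real.sqrt_div' _ (by positivity)]
    refine Real.sqrt_le_sqrt ?_
    calc 3 * K ^ 2 * BK / n ≤ 3 * x ^ 2 * (B * x ^ 16) / n := by gcongr
      _ = _ := by rw [hn]; field_simp
  have e2 : x ^ 2 / n ≤ 1 / x ^ 23 := by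
    rw [hn, div_le_div_iff₀ (by positivity) (by positivity), ← pow_add, one_mul]
    exact pow_le_pow_right₀ hx (by norm_num)
  have e3 : K ^ 2 / n ≤ 1 / x ^ 23 := le_trans (by gcongr) e2
  have e4 : K ^ 2 / m ≤ 2 / α / x ^ 23 := by
    calc K ^ 2 / m ≤ x ^ 2 / (α / 2 * n) := by gcongr
      _ = 2 / α * (x ^ 2 / n) := by field_simp
      _ ≤ 2 / α * (1 / x ^ 23) := by gcongr
      _ = _ := by ring
  calc _ ≤ x ^ 2 * (√(3 * B) / x ^ 23 + (1 / x ^ 23 + 2 / α / x ^ 23)) := by gcongr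
    _ = (√(3 * B) + 1 + 2 / α) * (x ^ 2 / x ^ 23) := by ring
    _ ≤ x * (x ^ 2 / x ^ 23) := by gcongr
    _ = (x ^ 20)⁻¹ := by field_simp
    _ ≤ _ := by
        gcongr
        norm_num

/-- With `K` a small multiple of `log n` and `m` of order `n`, the error terms of the Stein matrix
add up to at most `n ^ (-1 / 4)`. -/
lemma exists_errors_le {α : ℝ} (hα : 0 < α) {ρ : ℝ} (hρ1 : 1 ≤ ρ) {η : ℝ} (hη : 0 < η)
    (hη₀ : η ≤ 1 / (4 * Real.log (2025 * ρ ^ 2))) (hρα : 2 * (1 + α) ^ 2 ≤ ρ * α) :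
    ∃ N : ℕ, ∀ n : ℕ, N ≤ n → 0 < n ∧ ∀ m K : ℕ, m = ⌊α * n - η * Real.log n⌋₊ →
      K = ⌈η * Real.log n⌉₊ → 0 < m ∧ ((n : ℝ) + m) ^ 2 ≤ ρ * (n * m) ∧
        (K : ℝ) ^ 2 * (√(3 * K ^ 2 * (2025 * ρ ^ 2) ^ K / n)
          + ((K : ℝ) ^ 2 / n + (K : ℝ) ^ 2 / m)) ≤ (n : ℝ) ^ (-(1 / 4) : ℝ) := by
  set B := 2025 * ρ ^ 2 with hB
  have hB1 : 1 < B := by nlinarith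
  have hB0 : 0 < B := by linarith
  have hlogB : 0 < Real.log B := Real.log_pos hB1
  have hroot : Tendsto (fun n : ℕ => (n : ℝ) ^ (1 / 64 : ℝ)) atTop atTop :=
    (tendsto_rpow_atTop (by norm_num)).comp tendsto_natCast_atTop_atTop
  have hlog : ∀ᶠ n : ℕ in atTop, ‖Real.log n‖ ≤ 1 / (2 * η) * ‖(n : ℝ) ^ (1 / 64 : ℝ)‖ :=
    tendsto_natCast_atTop_atTop.eventually
      ((isLittleO_log_rpow_atTop (by norm_num : (0 : ℝ) < 1 / 64)).def (by positivity))
  obtain ⟨N, hN⟩ := eventually_atTop.1 ((eventually_gt_atTop 0).and (hlog.and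
    ((hroot.eventually_ge_atTop 2).and
      (hroot.eventually_ge_atTop (√(3 * B) + 1 + 2 / α)))))
  refine ⟨N, fun n hn => ?_⟩
  obtain ⟨hn0, hlogn, hx2, hxC⟩ := hN n hn
  refine ⟨hn0, fun m K hm hK => ?_⟩
  have hn0' : (0 : ℝ) < n := by exact_mod_cast hn0
  have hn1 : (1 : ℝ) ≤ n := by exact_mod_cast hn0
  have hln : 0 ≤ Real.log n := Real.log_nonneg hn1
  set x := (n : ℝ) ^ (1 / 64 : ℝ) with hx
  have hx0 : 0 < x := by linarith
  have hx1 : 1 ≤ x := by linarith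
  have hnx : (n : ℝ) = x ^ 64 := by
    rw [hx, ← Real.rpow_natCast, ← Real.rpow_mul hn0'.le]
    norm_num
  have hηlog : η * Real.log n + 1 ≤ x := by
    rw [Real.norm_of_nonneg hln, Real.norm_of_nonneg hx0.le] at hlogn
    have : η * Real.log n ≤ x / 2 :=
      (mul_le_mul_of_nonneg_left hlogn hη.le).trans (le_of_eq (by field_simp))
    linarith
  have hKlog : (K : ℝ) ≤ η * Real.log n + 1 := by
    rw [hK]
    exact (Nat.ceil_lt_add_one (by positivity)).le
  have hαx : x ≤ α / 2 * n := by
    have h1 : 2 / α ≤ x := by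
      have := Real.sqrt_nonneg (3 * B)
      linarith
    have h2 : 1 ≤ α / 2 * x := by
      rw [div_le_iff₀ hα] at h1
      linarith
    calc x ≤ x ^ 63 := le_self_pow₀ hx1 (by norm_num)
      _ = 1 * x ^ 63 := (one_mul _).symm
      _ ≤ α / 2 * x * x ^ 63 := by gcongr
      _ = α / 2 * n := by rw [hnx]; ring
  have hmlow : α / 2 * n ≤ m := by
    have := Nat.lt_floor_add_one (α * n - η * Real.log n)
    rw [← hm] at this
    linarith
  have hmup : (m : ℝ) ≤ α * n := by
    have h0 : 0 ≤ α * n - η * Real.log n := by nlinarith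
    have := Nat.floor_le h0
    rw [← hm] at this
    have : 0 ≤ η * Real.log n := by positivity
    linarith
  have hm0 : (0 : ℝ) < m := lt_of_lt_of_le (by positivity) hmlow
  have hBK : B ^ K ≤ B * x ^ 16 := by
    have h1 : η * Real.log B ≤ 1 / 4 := by
      rw [le_div_iff₀ (by positivity)] at hη₀
      linarith
    have h2 : (K : ℝ) * Real.log B ≤ Real.log B + 16 * Real.log x := by
      have h3 : Real.log n = 64 * Real.log x := by rw [hnx, Real.log_pow]; norm_num
      have h4 : (K : ℝ) * Real.log B ≤ (η * Real.log n + 1) * Real.log B := by gcongr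
      have h5 : η * Real.log B * Real.log n ≤ 1 / 4 * Real.log n := by gcongr
      linarith
    rw [← Real.log_le_log_iff (by positivity) (by positivity), Real.log_pow,
      Real.log_mul hB0.ne' (by positivity), Real.log_pow]
    exact_mod_cast h2
  refine ⟨by exact_mod_cast hm0, ?_, ?_⟩
  · calc ((n : ℝ) + m) ^ 2 ≤ (n + α * n) ^ 2 := by gcongr
      _ = 2 * (1 + α) ^ 2 * (n ^ 2 / 2) := by ring
      _ ≤ ρ * α * (n ^ 2 / 2) := by gcongr
      _ = ρ * (n * (α / 2 * n)) := by ring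
      _ ≤ _ := by gcongr
  · have h := sq_mul_errors_le hx1 hα hxC hnx (Nat.cast_nonneg K) (hKlog.trans hηlog)
      (by positivity) hBK hmlow
    refine h.trans (le_of_eq ?_)
    rw [hx, Real.rpow_neg hn0'.le, ← Real.rpow_natCast, ← Real.rpow_mul hn0'.le]
    norm_num

end Asymptotics

/-! ### Test functions with a bounded second derivative -/

section TestFunctions

variable {d : ℕ} {g : EuclideanSpace ℝ (Fin d) → ℝ}

lemma norm_iteratedFDeriv_le_derivSup {r : ℕ} (h : derivSup r g ≠ ⊤)
    (y : EuclideanSpace ℝ (Fin d)) : ‖iteratedFDeriv ℝ r g y‖ ≤ (derivSup r g).toReal := by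
  rw [← toReal_enorm]
  exact ENNReal.toReal_mono h (le_iSup (fun y => ‖iteratedFDeriv ℝ r g y‖ₑ) y)

lemma integrable_stdGaussian (hg : ContDiff ℝ 3 g) (h : derivSup 2 g ≠ ⊤) :
    Integrable g (stdGaussian (EuclideanSpace ℝ (Fin d))) := by
  rw [← map_pi_eq_stdGaussian, integrable_map_measure hg.continuous.aestronglyMeasurable
    (by fun_prop)]
  refine (integrable_comp_evalVec hg (norm_iteratedFDeriv_le_derivSup h)
    fun k : Fin d => MvPolynomial.X k).congr (ae_of_all _ fun x => ?_)
  simp [evalVec]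

end TestFunctions

end SymmetricPerceptron

open SymmetricPerceptron

theorem proposition3p6 (κ : ℝ) (hκ : 0 < κ) :
    ∃ η₀ : ℝ, 0 < η₀ ∧ ∀ η : ℝ, 0 < η → η ≤ η₀ →
      ∃ N : ℕ, ∀ n : ℕ, N ≤ n →
        ∀ (Ω : Type*) [MeasurableSpace Ω] (P : Measure Ω) [IsProbabilityMeasure P]
          (G : ℕ → Ω → EuclideanSpace ℝ (Fin n)),
          (∀ j : ℕ, HasLaw (G j) (stdGaussian (EuclideanSpace ℝ (Fin n))) P) →
          iIndepFun G P →
          ∀ g : EuclideanSpace ℝ (Fin (SymmetricPerceptron.cycleBound η n)) → ℝ,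
            ContDiff ℝ 3 g →
            (SymmetricPerceptron.derivSup 2 g ≠ ⊤ →
              Integrable (fun ω => g (SymmetricPerceptron.cycleVector
                (SymmetricPerceptron.cycleBound η n) (SymmetricPerceptron.tauPre κ η n)
                (fun j => G j ω))) P ∧
              Integrable g
                (stdGaussian (EuclideanSpace ℝ (Fin (SymmetricPerceptron.cycleBound η n))))) ∧
            ENNReal.ofReal
                |(∫ ω, g (SymmetricPerceptron.cycleVector
                    (SymmetricPerceptron.cycleBound η n) (SymmetricPerceptron.tauPre κ η n)
                    (fun j => G j ω)) ∂P)
                  - ∫ z, g z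
                    ∂(stdGaussian
                      (EuclideanSpace ℝ (Fin (SymmetricPerceptron.cycleBound η n))))|
              ≤ (SymmetricPerceptron.derivSup 2 g + SymmetricPerceptron.derivSup 3 g)
                * ENNReal.ofReal ((n : ℝ) ^ (-(1 / 4) : ℝ)) := by
  have hα := alphaC_pos hκ
  -- `ρ` bounds the ratio of `(n + m) ^ 2` and `n * m`, given that `α_c n / 2 ≤ m ≤ α_c n`
  set ρ : ℝ := 2 * (1 + alphaC κ) ^ 2 / alphaC κ with hρ
  have hρα : 2 * (1 + alphaC κ) ^ 2 = ρ * alphaC κ := by rw [hρ]; field_simp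
  have hρ1 : 1 ≤ ρ := by
    rw [hρ, le_div_iff₀ hα]
    nlinarith
  have hlog : 0 < Real.log (2025 * ρ ^ 2) := Real.log_pos (by nlinarith)
  -- `(2025 * ρ ^ 2) ^ K` controls the variance of the Stein matrix and has to be `O(n ^ (1 / 4))`
  refine ⟨1 / (4 * Real.log (2025 * ρ ^ 2)), by positivity, fun η hη hη₀ => ?_⟩
  obtain ⟨N, hN⟩ := exists_errors_le hα hρ1 hη hη₀ hρα.le
  refine ⟨N, fun n hn Ω _ P _ G hG hI g hg => ?_⟩
  obtain ⟨hn0, hN⟩ := hN n hn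
  obtain ⟨hm0, hnm, herr⟩ := hN (tauPre κ η n) (cycleBound η n) rfl rfl
  generalize tauPre κ η n = m at *
  generalize cycleBound η n = K at *
  have hn0' : (0 : ℝ) < n := by exact_mod_cast hn0
  obtain ⟨hmeas, hmap⟩ := map_entries_eq_stdPi (m := m) hG hI
  have hcont : Continuous fun x : Fin m × Fin n → ℝ =>
      g (evalVec (fun k : Fin K => cycleCoord n m k) x) := hg.continuous.comp (continuous_evalVec _)
  have hvec (ω : Ω) : g (cycleVector K m fun j => G j ω) = g (evalVec (fun k : Fin K =>
      cycleCoord n m k) fun e : Fin m × Fin n => G e.1 ω e.2) := by rw [cycleVector_eq_evalVec]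
  refine ⟨fun h => ⟨?_, integrable_stdGaussian hg h⟩, ?_⟩
  · have hi := integrable_comp_evalVec hg (norm_iteratedFDeriv_le_derivSup h)
      fun k : Fin K => cycleCoord n m k
    rw [← hmap, integrable_map_measure hcont.aestronglyMeasurable hmeas] at hi
    exact hi.congr (ae_of_all _ fun ω => (hvec ω).symm)
  by_cases h : derivSup 2 g = ⊤
  · -- `n ≥ 1`, so the right-hand side is not `⊤ * 0`
    rw [h, top_add, ENNReal.top_mul (ENNReal.ofReal_pos.2 (Real.rpow_pos_of_pos hn0' _)).ne']
    exact le_top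
  · have hint : ∫ ω, g (cycleVector K m fun j => G j ω) ∂P
        = ∫ x, g (evalVec (fun k : Fin K => cycleCoord n m k) x) ∂(stdPi (Fin m × Fin n)) := by
      rw [← hmap, integral_map hmeas hcont.aestronglyMeasurable]
      exact integral_congr_ae (ae_of_all _ hvec)
    have hstein := abs_integral_sub_stdGaussian_le hg (norm_iteratedFDeriv_le_derivSup h)
      (fun k : Fin K => cycleCoord n m k) (fun k : Fin K => pathCoord n m k)
      fun k => (gaussDiv_pathCoord k).symm
    have hsum := Finset.sum_le_sum fun (k : Fin K) (_ : k ∈ Finset.univ) =>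
      Finset.sum_le_sum fun (l : Fin K) (_ : l ∈ Finset.univ) =>
        integral_abs_steinMatrix_sub_le hn0 hm0 hρ1 hnm k l
    simp only [Finset.sum_const, Finset.card_univ, Fintype.card_fin, nsmul_eq_mul,
      ← mul_assoc, ← sq] at hsum
    calc _ ≤ ENNReal.ofReal ((derivSup 2 g).toReal * (n : ℝ) ^ (-(1 / 4) : ℝ)) := by
          refine ENNReal.ofReal_le_ofReal ?_
          rw [hint]
          refine hstein.trans (mul_le_mul_of_nonneg_left ?_ ENNReal.toReal_nonneg)
          exact hsum.trans herr
      _ = derivSup 2 g * ENNReal.ofReal ((n : ℝ) ^ (-(1 / 4) : ℝ)) := by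
          rw [ENNReal.ofReal_mul ENNReal.toReal_nonneg, ENNReal.ofReal_toReal h]
      _ ≤ _ := by
          gcongr
          exact le_self_add
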